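/- Let $k$ be an algebraically closed field and let $\Gamma$ be a Dynkin quiver with vertex set $I$, i.e. a finite quiver whose underlying unoriented graph is a disjoint union of Dynkin diagrams of types $A_n$, $D_n$, $E_6$, $E_7$, $E_8$. Let $\mathrm{rep}\,\Gamma$ be the category of finite-dimensional representations of $\Gamma$ over $k$. A decorated representation $M=M^+\oplus V$ of $\Gamma$ consists of a representation $M^+=((M_j)_{j\in I},(M_a)_a)\in\mathrm{rep}\,\Gamma$ and an $I$-graded finite-dimensional vector space $V=(V_j)_{j\in I}$. For decorated representations $M=M^+\oplus V$ and $N=N^+\oplus W$ put $$E_\Gamma(M,N)=\mathrm{Ext}^1_\Gamma(M^+,N^+)\oplus\mathrm{Ext}^1_\Gamma(N^+,M^+)^*\oplus\bigoplus_{j\in I}\mathrm{Hom}_k(M_j,W_j)\oplus\bigoplus_{j\in I}\mathrm{Hom}_k(V_j,N_j),$$ where $\mathrm{Ext}^1_\Gamma$ is taken in $\mathrm{rep}\,\Gamma$ and $^*$ is the $k$-linear dual. For a vertex $i$ that is a source or a sink, let $s_i\Gamma$ be the quiver obtained from $\Gamma$ by reversing all arrows at $i$. The extended reflection functor $\Sigma_i$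 sends a decorated representation $M=M^+\oplus V$ of $\Gamma$ to the following decorated representation of $s_i\Gamma$. If $i$ is a source, let $\mu:M_i\to\bigoplus_{a:i\to j}M_j$ be the map with components $M_a$. Then $M_i$ is replaced by $\mathrm{Coker}(\mu)\oplus V_i$, and $V_i$ is replaced by $\mathrm{Ker}(\mu)$. The reversal of an arrow $a:i\to j$ acts by the canonical map $M_j\to\mathrm{Coker}(\mu)$ followed by the inclusion into $\mathrm{Coker}(\mu)\oplus V_i$. If $i$ is a sink, let $\nu:\bigoplus_{a:j\to i}M_j\to M_i$ be the map with components $M_a$. Then $M_i$ is replaced by $\mathrm{Ker}(\nu)\oplus V_i$, and $V_i$ is replaced by $\mathrm{Coker}(\nu)$. The reversal of an arrow $a:j\to i$ acts by the projection onto $\mathrm{Ker}(\nu)$ followed by the canonical map $\mathrm{Ker}(\nu)\to M_j$. All other spaces and maps are unchanged. **Theorem.** If $i\in I$ is a source or a sink of $\Gamma$, then for all decorated representations $M$ and $N$ of $\Gamma$ there is an isomorphism of $k$-vector spaces $$E_{s_i\Gamma}(\Sigma_i M,\Sigma_i N)\cong E_\Gamma(M,N).$$ -/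

import Mathlib

universe u

open CategoryTheory

noncomputable section

/-! ### Dynkin quivers -/

section Quivers

variable (I : Type u) [Quiver.{u} I]

open Classical in
/-- The generalized Cartan matrix of the underlying unoriented graph of a finite quiver: the
`(j, l)` entry is `2δ_{jl}` minus the number of arrows `j ⟶ l` and the number of arrows `l ⟶ j`. -/
def quiverCartan (j l : I) : ℤ :=
  (if j = l then 2 else 0) - (Nat.card (j ⟶ l) : ℤ) - (Nat.card (l ⟶ j) : ℤ)

/-- A (finite) quiver is a Dynkin quiver if its underlying unoriented graph is a disjoint union of
Dynkin diagrams of type `A_n` (`n ≥ 1`), `D_n` (`n ≥ 4`), `E_6`, `E_7`, `E_8`: the vertices of each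
connected component can be numbered in such a way that the Cartan matrix of the component is one
of the Cartan matrices of these types. -/
def IsDynkinQuiver : Prop :=
  ∀ c : Quiver.WeaklyConnectedComponent I,
    ∃ (n : ℕ) (C : Matrix (Fin n) (Fin n) ℤ)
      (e : {j : I // Quiver.WeaklyConnectedComponent.mk j = c} ≃ Fin n),
      (C = CartanMatrix.A n ∨ (4 ≤ n ∧ C = CartanMatrix.D n) ∨
        (⟨n, C⟩ : Σ m : ℕ, Matrix (Fin m) (Fin m) ℤ) = ⟨6, CartanMatrix.E₆⟩ ∨
        (⟨n, C⟩ : Σ m : ℕ, Matrix (Fin m) (Fin m) ℤ) = ⟨7, CartanMatrix.E₇⟩ ∨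
        (⟨n, C⟩ : Σ m : ℕ, Matrix (Fin m) (Fin m) ℤ) = ⟨8, CartanMatrix.E₈⟩) ∧
      ∀ j l, quiverCartan I j.1 l.1 = C (e j) (e l)

variable {I}

/-- The vertex `i` is a source: no arrow points to `i`. -/
def IsQuiverSource (i : I) : Prop := ∀ j : I, IsEmpty (j ⟶ i)

/-- The vertex `i` is a sink: no arrow starts at `i`. -/
def IsQuiverSink (i : I) : Prop := ∀ j : I, IsEmpty (i ⟶ j)

lemma IsQuiverSource.ne {i : I} (hi : IsQuiverSource i) {l : I} (a : i ⟶ l) : l ≠ i := by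
  rintro rfl
  exact (hi _).false a

lemma IsQuiverSink.ne {i : I} (hi : IsQuiverSink i) {j : I} (a : j ⟶ i) : j ≠ i := by
  rintro rfl
  exact (hi _).false a

/-- The set of vertices of the reflected quiver `s_i Γ`; these are the vertices of `Γ`. -/
def Reflected (_i : I) : Type u := I

/-- The arrows of `s_i Γ`: all arrows of `Γ` that do not touch `i` are kept, and all arrows of `Γ`
that start or end at `i` are reversed. -/
inductive ReflectedHom (i : I) : I → I → Type u
  | keep {j l : I} (hj : j ≠ i) (hl : l ≠ i) (a : j ⟶ l) : ReflectedHom i j l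
  | revOut {l : I} (a : i ⟶ l) : ReflectedHom i l i
  | revIn {j : I} (a : j ⟶ i) : ReflectedHom i i j

instance (i : I) : Quiver.{u} (Reflected i) where
  Hom j l := ReflectedHom i j l

end Quivers

/-! ### Representations, decorated representations and the spaces `E_Γ(M, N)` -/

section Representations

variable (k : Type u) [Field k] (I : Type u) [Quiver.{u} I]

/-- The category `rep Γ` of finite-dimensional representations of a quiver over `k` (functors from
the path category to finite-dimensional vector spaces), with Mathlib's structure of a `k`-linear
abelian category. -/
abbrev QuiverRep : Type (u + 1) := Paths I ⥤ FGModuleCat.{u} k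

variable {k I}

/-- The vector space `M_j`. -/
abbrev QuiverRep.space (M : QuiverRep k I) (j : I) : FGModuleCat.{u} k :=
  M.obj ((Paths.of I).obj j)

/-- The linear map `M_a : M_j → M_l` of an arrow `a : j ⟶ l`. -/
abbrev QuiverRep.arrowMap (M : QuiverRep k I) {j l : I} (a : j ⟶ l) :
    M.space j →ₗ[k] M.space l :=
  (M.map ((Paths.of I).map a)).hom.hom

/-- `Ext¹_Γ(M, N)`, computed in the abelian category `rep Γ`. -/
def QuiverRep.Ext1 (M N : QuiverRep k I) : Type (u + 1) :=
  letI := HasExt.standard (QuiverRep k I)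
  Abelian.Ext M N 1

instance (M N : QuiverRep k I) : AddCommGroup (M.Ext1 N) :=
  letI := HasExt.standard (QuiverRep k I)
  inferInstanceAs (AddCommGroup (Abelian.Ext M N 1))

instance (M N : QuiverRep k I) : Module k (M.Ext1 N) :=
  letI := HasExt.standard (QuiverRep k I)
  inferInstanceAs (Module k (Abelian.Ext M N 1))

variable (k I) in
/-- A decorated representation `M = M⁺ ⊕ V` of a quiver: a finite-dimensional representation `M⁺`
together with a family `V = (V_j)` of finite-dimensional vector spaces, one for each vertex. -/
structure DecoratedRep : Type (u + 1) where
  /-- The representation `M⁺`. -/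
  pos : QuiverRep k I
  /-- The spaces `V_j`. -/
  dec : I → FGModuleCat.{u} k

/-- `E_Γ(M, N) = Ext¹(M⁺, N⁺) ⊕ Ext¹(N⁺, M⁺)^* ⊕ Hom^I(M⁺, W) ⊕ Hom^I(V, N⁺)`, where `M = M⁺ ⊕ V`
and `N = N⁺ ⊕ W`. -/
abbrev DecoratedRep.E (M N : DecoratedRep k I) : Type (u + 1) :=
  M.pos.Ext1 N.pos × Module.Dual k (N.pos.Ext1 M.pos) ×
    ((j : I) → (M.pos.space j →ₗ[k] N.dec j)) × ((j : I) → (M.dec j →ₗ[k] N.pos.space j))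

end Representations

/-! ### Extended reflection functors on objects -/

section Reflection

variable {k : Type u} [Field k] {I : Type u} [DecidableEq I] [Quiver.{u} I] {i : I}

/-- The family of spaces obtained from `(M_j)` by replacing `M_i` by `X`. -/
abbrev QuiverRep.replace (M : QuiverRep k I) (i : I) (X : FGModuleCat.{u} k) :
    I → FGModuleCat.{u} k :=
  Function.update (fun j => M.space j) i X

lemma QuiverRep.replace_self (M : QuiverRep k I) (X : FGModuleCat.{u} k) :
    M.replace i X i = X := Function.update_self ..

lemma QuiverRep.replace_of_ne (M : QuiverRep k I) (X : FGModuleCat.{u} k) {j : I} (hj : j ≠ i) :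
    M.replace i X j = M.space j := Function.update_of_ne hj ..

/-- For a source `i` of `Γ`: the representation of `s_i Γ` obtained from `M` by replacing `M_i` by
`X`, where the reversals of the arrows `a : i → l` of `Γ` act by given maps `φ_a : M_l → X`. -/
def QuiverRep.replaceSource (hi : IsQuiverSource i) (M : QuiverRep k I) (X : FGModuleCat.{u} k)
    (φ : ∀ a : Σ l : I, (i ⟶ l), M.space a.1 ⟶ X) : QuiverRep k (Reflected i) :=
  Paths.lift (V := Reflected i)
    { obj := M.replace i X
      map := fun {_ _} b => match b with
        | ReflectedHom.keep hj hl a =>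
            eqToHom (M.replace_of_ne X hj) ≫ M.map ((Paths.of I).map a) ≫
              eqToHom (M.replace_of_ne X hl).symm
        | ReflectedHom.revOut a =>
            eqToHom (M.replace_of_ne X (hi.ne a)) ≫ φ ⟨_, a⟩ ≫ eqToHom (M.replace_self X).symm
        | ReflectedHom.revIn a => ((hi _).false a).elim }

/-- For a sink `i` of `Γ`: the representation of `s_i Γ` obtained from `M` by replacing `M_i` by
`X`, where the reversals of the arrows `a : j → i` of `Γ` act by given maps `φ_a : X → M_j`. -/
def QuiverRep.replaceSink (hi : IsQuiverSink i) (M : QuiverRep k I) (X : FGModuleCat.{u} k)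
    (φ : ∀ a : Σ j : I, (j ⟶ i), X ⟶ M.space a.1) : QuiverRep k (Reflected i) :=
  Paths.lift (V := Reflected i)
    { obj := M.replace i X
      map := fun {_ _} b => match b with
        | ReflectedHom.keep hj hl a =>
            eqToHom (M.replace_of_ne X hj) ≫ M.map ((Paths.of I).map a) ≫
              eqToHom (M.replace_of_ne X hl).symm
        | ReflectedHom.revOut a => ((hi _).false a).elim
        | ReflectedHom.revIn a =>
            eqToHom (M.replace_self X) ≫ φ ⟨_, a⟩ ≫ eqToHom (M.replace_of_ne X (hi.ne a)).symm }

variable [Fintype I] [∀ j l : I, Fintype (j ⟶ l)]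

/-- The map `M_i → ⨁_{a : i → j} M_j` with components `M_a`. -/
def QuiverRep.outMap (M : QuiverRep k I) (i : I) :
    M.space i →ₗ[k] ((a : Σ j : I, (i ⟶ j)) → M.space a.1) :=
  LinearMap.pi fun a => M.arrowMap a.2

/-- The map `⨁_{a : j → i} M_j → M_i` with components `M_a`. -/
def QuiverRep.inMap (M : QuiverRep k I) (i : I) :
    ((a : Σ j : I, (j ⟶ i)) → M.space a.1) →ₗ[k] M.space i :=
  ∑ a : Σ j : I, (j ⟶ i), M.arrowMap a.2 ∘ₗ LinearMap.proj a

open Classical in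
/-- `Σ_i(M)` for a source `i`: `M_i` is replaced by `Coker(M_i → ⨁_{i → l} M_l) ⊕ V_i`, with the
reversed arrows acting by the canonical maps from `M_l` to the cokernel (and by zero to `V_i`);
`V_i` is replaced by `Ker(M_i → ⨁_{i → l} M_l)`; everything else is unchanged. -/
def DecoratedRep.sigmaSource (hi : IsQuiverSource i) (M : DecoratedRep k I) :
    DecoratedRep k (Reflected i) where
  pos := M.pos.replaceSource hi
    (FGModuleCat.of k
      ((((a : Σ j : I, (i ⟶ j)) → M.pos.space a.1) ⧸ LinearMap.range (M.pos.outMap i)) × M.dec i))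
    (fun a => FGModuleCat.ofHom
      (LinearMap.inl k _ (M.dec i) ∘ₗ (LinearMap.range (M.pos.outMap i)).mkQ ∘ₗ
        LinearMap.single k (fun a : Σ j : I, (i ⟶ j) => M.pos.space a.1) a))
  dec := Function.update (α := I) M.dec i (FGModuleCat.of k (LinearMap.ker (M.pos.outMap i)))

/-- `Σ_i(M)` for a sink `i`: `M_i` is replaced by `Ker(⨁_{j → i} M_j → M_i) ⊕ V_i`, with the
reversed arrows acting by the canonical maps from the kernel to `M_j` (and by zero on `V_i`);
`V_i` is replaced by `Coker(⨁_{j → i} M_j → M_i)`; everything else is unchanged. -/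
def DecoratedRep.sigmaSink (hi : IsQuiverSink i) (M : DecoratedRep k I) :
    DecoratedRep k (Reflected i) where
  pos := M.pos.replaceSink hi
    (FGModuleCat.of k (LinearMap.ker (M.pos.inMap i) × M.dec i))
    (fun a => FGModuleCat.ofHom
      (LinearMap.proj a ∘ₗ (LinearMap.ker (M.pos.inMap i)).subtype ∘ₗ
        LinearMap.fst k (LinearMap.ker (M.pos.inMap i)) (M.dec i)))
  dec := Function.update (α := I) M.dec i
    (FGModuleCat.of k (M.pos.space i ⧸ LinearMap.range (M.pos.inMap i)))

end Reflection

end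

/-!
All spaces involved are finite-dimensional, so it suffices to compare the dimensions of both sides.
This works for an arbitrary finite quiver over an arbitrary field.

**Extension spaces.** A family `c` of maps `c_a : M_j → N_l`, one for each arrow `a : j → l`, defines
an extension of `M` by `N` with upper triangular action of the arrows, and the resulting linear map
`c ↦ [X_c]` to `Ext¹(M, N)` is surjective with kernel the coboundaries
(`extensionClass_eq_zero_iff`, `extensionClass_surjective`). Linearity comes from functoriality of
extension classes. Surjectivity uses that every class of positive degree is killed by an epimorphism
onto its first argument (`exists_epi_mk₀_comp_eq_zero`), so that it is a pushforward of the class of a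
short exact sequence, and that such sequences split at every vertex. This gives Ringel's formula
`QuiverRep.finrank_ext1_add`, which computes `dim Ext¹(M, N)` from `dim Hom(M, N)` and the dimension
vectors.

**Morphisms.** Let `i` be a source and `μ_M : M_i → M_out = ⨁ M_l` the map given by the arrows at `i`.
A family of maps at the other vertices that commutes with the arrows away from `i` extends to a
morphism `M → N` if and only if the map `M_out → N_out` it induces sends `Im μ_M` into `Im μ_N`. For
the reflected representations, in which `M_out` maps to `Coker μ_M ⊕ V_i` with kernel `Im μ_M`, the
condition is the same (`exists_comp_eq_comp_iff_coker`). Hence restriction to the other vertices has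
the same image on both `Hom` spaces, and its kernels are `Hom(M_i, Ker μ_N)` and
`Hom(V_i, Coker μ_N ⊕ W_i)`. The case of a sink is dual (`exists_comp_eq_comp_iff_ker`).

**Conclusion.** With Ringel's formula this yields the difference of `dim Ext¹(ΣM, ΣN)` and
`dim Ext¹(M, N)` in terms of dimensions at `i`: for a source it is
`dim Im μ_M * dim W_i - dim Ker μ_M * dim Coker μ_N`. Adding the same difference with `M` and `N`
exchanged, one finds exactly the negative of the change of the two remaining summands of `E`.
-/

universe w v u' v'

noncomputable section

/-! ### Effaceability of positive-degree extension classes -/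

section Effaceability

open Limits Category

variable {C : Type u} [Category.{v} C] [Abelian C]

open HomologicalComplex in
/-- If a complex `K` concentrated in degrees `≤ i` resolves an object `X` placed in degree `i`, then
the augmentation `K.X i ⟶ X` is an epimorphism. -/
lemma CochainComplex.epi_f_comp_singleObjXSelf {X : C} {K : CochainComplex C ℤ} {i : ℤ}
    (π : K ⟶ (single C (ComplexShape.up ℤ) i).obj X) [K.IsStrictlyLE i] [QuasiIsoAt π i] :
    Epi (π.f i ≫ (singleObjXSelf (ComplexShape.up ℤ) i X).hom) := by
  let e := K.iCyclesIso i (i + 1) (by simp)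
    ((K.isZero_of_isStrictlyLE i (i + 1) (by simp)).eq_of_tgt _ _)
  have : π.f i ≫ (singleObjXSelf (ComplexShape.up ℤ) i X).hom =
      e.inv ≫ K.homologyπ i ≫ homologyMap π i ≫ (singleObjHomologySelfIso _ _ _).hom := by
    rw [← cancel_epi e.hom, ← cancel_mono (singleObjXSelf (ComplexShape.up ℤ) i X).inv]
    rw [assoc, assoc, assoc, assoc, e.hom_inv_id_assoc, assoc, assoc, homologyπ_naturality_assoc,
      homologyπ_singleObjHomologySelfIso_hom_assoc, ← singleObjCyclesSelfIso_inv_iCycles,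
      Iso.hom_inv_id_assoc,
      singleObjCyclesSelfIso_inv_iCycles, Iso.hom_inv_id, comp_id, cyclesMap_i]
    rfl
  rw [this]
  infer_instance

open DerivedCategory in
/-- Every class in `Extⁿ⁺¹(X, Y)` vanishes after pullback along some epimorphism `P ⟶ X`; no
projective objects are needed. -/
lemma CategoryTheory.Abelian.Ext.exists_epi_mk₀_comp_eq_zero [HasExt.{w} C] {X Y : C} {n : ℕ}
    (e : Ext X Y (n + 1)) :
    ∃ (P : C) (p : P ⟶ X) (_ : Epi p), (mk₀ p).comp e (zero_add _) = 0 := by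
  let := HasDerivedCategory.standard C
  -- `e` becomes a morphism from `X` in degree `0` to `Y` in degree `-(n + 1)`, hence a fraction
  -- `X ← K → Y` with `K` in nonpositive degrees; `P` is the term `K.X 0`, which is a subcomplex of
  -- `K` because `K` vanishes in degree `1`, and which maps to zero in degree `-(n + 1)`.
  let s : ((singleFunctor C 0).obj Y)⟦((n + 1 : ℕ) : ℤ)⟧ ⟶
      Q.obj ((CochainComplex.singleFunctor C (-((n + 1 : ℕ) : ℤ))).obj Y) :=
    ((singleFunctors C).shiftIso ((n + 1 : ℕ) : ℤ) (-((n + 1 : ℕ) : ℤ)) 0 (by lia)).hom.app Y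
  have : IsIso s := inferInstanceAs (IsIso
    (((singleFunctors C).shiftIso ((n + 1 : ℕ) : ℤ) (-((n + 1 : ℕ) : ℤ)) 0 (by lia)).hom.app Y))
  obtain ⟨K, _, π, h, g, fac⟩ := right_fac_of_isStrictlyLE
    (X := (CochainComplex.singleFunctor C 0).obj X)
    (Y := (CochainComplex.singleFunctor C (-((n + 1 : ℕ) : ℤ))).obj Y) (e.hom ≫ s) 0
  have hq : QuasiIso π := by rwa [isIso_Q_map_iff_quasiIso] at h
  let π' : K ⟶ (HomologicalComplex.single C (ComplexShape.up ℤ) 0).obj X := π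
  have hq' : QuasiIso π' := hq
  let ι : (HomologicalComplex.single C (ComplexShape.up ℤ) 0).obj (K.X 0) ⟶ K :=
    HomologicalComplex.mkHomFromSingle (𝟙 _) (by
      rintro _ rfl
      apply (K.isZero_of_isStrictlyLE 0 (0 + 1) (by simp)).eq_of_tgt)
  let p : K.X 0 ⟶ X :=
    π'.f 0 ≫ (HomologicalComplex.singleObjXSelf (ComplexShape.up ℤ) 0 X).hom
  have hg : ι ≫ g = 0 := by
    apply HomologicalComplex.from_single_hom_ext
    apply (((CochainComplex.singleFunctor C (-((n + 1 : ℕ) : ℤ))).obj Y).isZero_of_isStrictlyLE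
      (-((n + 1 : ℕ) : ℤ)) 0 (by lia)).eq_of_tgt
  have hp : (HomologicalComplex.single C (ComplexShape.up ℤ) 0).map p = ι ≫ π' := by
    apply HomologicalComplex.from_single_hom_ext
    rw [HomologicalComplex.single_map_f_self, HomologicalComplex.comp_f,
      HomologicalComplex.mkHomFromSingle_f]
    simp [p]
  refine ⟨K.X 0, p, CochainComplex.epi_f_comp_singleObjXSelf π', Ext.ext ?_⟩
  have h3 : (singleFunctor C 0).map p = Q.map ι ≫ Q.map π := by
    rw [← Q.map_comp]
    exact congr_arg Q.map hp
  have h4 : (singleFunctor C 0).map p ≫ e.hom = 0 := by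
    have h5 : (singleFunctor C 0).map p ≫ e.hom ≫ s =
        (Q.map ι ≫ Q.map π) ≫ inv (Q.map π) ≫ Q.map g :=
      congr_arg₂ (fun a b => a ≫ b) h3 fac
    rw [← cancel_mono s, assoc, Limits.zero_comp, h5, assoc, IsIso.hom_inv_id_assoc]
    exact (Q.map_comp ι g).symm.trans ((congr_arg Q.map hg).trans (Q.map_zero _ _))
  simpa [ShiftedHom.mk₀_comp, Ext.zero_hom] using h4

end Effaceability

/-! ### Extensions of quiver representations by cocycles -/

section Extensions

open Limits Category

variable {C : Type u} [Category.{v} C] {I : Type u'} [Quiver.{v'} I]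

namespace CategoryTheory.Paths

/-- The object of a representation `Paths I ⥤ C` at a vertex. -/
abbrev vtx (M : Paths I ⥤ C) (j : I) : C := M.obj ((Paths.of I).obj j)

/-- The morphism by which an arrow acts in a representation. -/
abbrev arr (M : Paths I ⥤ C) {j l : I} (a : j ⟶ l) : vtx M j ⟶ vtx M l :=
  M.map ((Paths.of I).map a)

/-- The component at a vertex of a morphism of representations. -/
abbrev comp {M N : Paths I ⥤ C} (f : M ⟶ N) (j : I) : vtx M j ⟶ vtx N j :=
  f.app ((Paths.of I).obj j)

lemma arr_naturality {M N : Paths I ⥤ C} (f : M ⟶ N) {j l : I} (a : j ⟶ l) :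
    arr M a ≫ comp f l = comp f j ≫ arr N a := f.naturality _

lemma arr_lift (φ : I ⥤q C) {j l : I} (a : j ⟶ l) : arr (Paths.lift φ) a = φ.map a :=
  Paths.lift_toPath φ a

/-- A morphism of representations, given by components that commute with the arrows. -/
def homMk {M N : Paths I ⥤ C} (f : ∀ j : I, vtx M j ⟶ vtx N j)
    (hf : ∀ {j l : I} (a : j ⟶ l), arr M a ≫ f l = f j ≫ arr N a) : M ⟶ N :=
  Paths.liftNatTrans f hf

lemma hom_ext {M N : Paths I ⥤ C} {f g : M ⟶ N} (h : ∀ j : I, comp f j = comp g j) : f = g :=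
  NatTrans.ext (funext h)

/-- Families of morphisms `M_j ⟶ N_j`, without any compatibility with the arrows. -/
abbrev Cochain0 (M N : Paths I ⥤ C) : Type _ := (j : I) → (vtx M j ⟶ vtx N j)

/-- Families of morphisms `M_j ⟶ N_l`, one for each arrow `j ⟶ l`. -/
abbrev Cochain1 (M N : Paths I ⥤ C) : Type _ :=
  (a : Σ j l : I, (j ⟶ l)) → (vtx M a.1 ⟶ vtx N a.2.1)

variable [Abelian C]

/-- The extension of `M` by `N` with objects `N_j ⊞ M_j`, on which an arrow `a` acts by the
upper triangular matrix with diagonal entries `N_a`, `M_a` and off-diagonal entry `c_a`. -/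
def extension {M N : Paths I ⥤ C} (c : Cochain1 M N) : Paths I ⥤ C :=
  Paths.lift
    { obj := fun j => vtx N j ⊞ vtx M j
      map := fun {j l} a => biprod.fst ≫ arr N a ≫ biprod.inl +
        biprod.snd ≫ (c ⟨j, l, a⟩ ≫ biprod.inl + arr M a ≫ biprod.inr) }

variable {M N : Paths I ⥤ C}

/-- The inclusion of `N_j` into the extension. -/
def extensionInl (c : Cochain1 M N) (j : I) : vtx N j ⟶ vtx (extension c) j :=
  (biprod.inl : vtx N j ⟶ vtx N j ⊞ vtx M j)

/-- The inclusion of `M_j` into the extension; it does not commute with the arrows. -/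
def extensionInr (c : Cochain1 M N) (j : I) : vtx M j ⟶ vtx (extension c) j :=
  (biprod.inr : vtx M j ⟶ vtx N j ⊞ vtx M j)

/-- The projection of the extension onto `N_j`; it does not commute with the arrows. -/
def extensionFst (c : Cochain1 M N) (j : I) : vtx (extension c) j ⟶ vtx N j :=
  (biprod.fst : vtx N j ⊞ vtx M j ⟶ vtx N j)

/-- The projection of the extension onto `M_j`. -/
def extensionSnd (c : Cochain1 M N) (j : I) : vtx (extension c) j ⟶ vtx M j :=
  (biprod.snd : vtx N j ⊞ vtx M j ⟶ vtx M j)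

@[simp]
lemma extensionInl_fst (c : Cochain1 M N) (j : I) :
    extensionInl c j ≫ extensionFst c j = 𝟙 _ := biprod.inl_fst

@[simp]
lemma extensionInl_fst_assoc (c : Cochain1 M N) (j : I) {Z : C} (h : _ ⟶ Z) :
    extensionInl c j ≫ extensionFst c j ≫ h = h := by
  rw [← assoc, extensionInl_fst, id_comp]

@[simp]
lemma extensionInl_snd (c : Cochain1 M N) (j : I) :
    extensionInl c j ≫ extensionSnd c j = 0 := biprod.inl_snd

@[simp]
lemma extensionInl_snd_assoc (c : Cochain1 M N) (j : I) {Z : C} (h : _ ⟶ Z) :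
    extensionInl c j ≫ extensionSnd c j ≫ h = 0 := by
  rw [← assoc, extensionInl_snd, zero_comp]

@[simp]
lemma extensionInr_fst (c : Cochain1 M N) (j : I) :
    extensionInr c j ≫ extensionFst c j = 0 := biprod.inr_fst

@[simp]
lemma extensionInr_fst_assoc (c : Cochain1 M N) (j : I) {Z : C} (h : _ ⟶ Z) :
    extensionInr c j ≫ extensionFst c j ≫ h = 0 := by
  rw [← assoc, extensionInr_fst, zero_comp]

@[simp]
lemma extensionInr_snd (c : Cochain1 M N) (j : I) :
    extensionInr c j ≫ extensionSnd c j = 𝟙 _ := biprod.inr_snd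

@[simp]
lemma extensionInr_snd_assoc (c : Cochain1 M N) (j : I) {Z : C} (h : _ ⟶ Z) :
    extensionInr c j ≫ extensionSnd c j ≫ h = h := by
  rw [← assoc, extensionInr_snd, id_comp]

lemma extension_total (c : Cochain1 M N) (j : I) :
    extensionFst c j ≫ extensionInl c j + extensionSnd c j ≫ extensionInr c j = 𝟙 _ :=
  biprod.total

lemma arr_extension (c : Cochain1 M N) {j l : I} (a : j ⟶ l) :
    arr (extension c) a = extensionFst c j ≫ arr N a ≫ extensionInl c l +
      extensionSnd c j ≫ (c ⟨j, l, a⟩ ≫ extensionInl c l + arr M a ≫ extensionInr c l) :=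
  arr_lift _ a

instance (c : Cochain1 M N) (j : I) : Mono (extensionInl c j) :=
  inferInstanceAs (Mono (biprod.inl : vtx N j ⟶ vtx N j ⊞ vtx M j))

instance (c : Cochain1 M N) (j : I) : Epi (extensionSnd c j) :=
  inferInstanceAs (Epi (biprod.snd : vtx N j ⊞ vtx M j ⟶ vtx M j))

/-- The inclusion of `N` as a subrepresentation of the extension. -/
def extensionι (c : Cochain1 M N) : N ⟶ extension c :=
  homMk (extensionInl c) fun {j l} a => by simp [arr_extension]

/-- The projection of the extension onto its quotient `M`. -/
def extensionπ (c : Cochain1 M N) : extension c ⟶ M :=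
  homMk (extensionSnd c) fun {j l} a => by simp [arr_extension]

@[simp] lemma comp_extensionι (c : Cochain1 M N) (j : I) :
    comp (extensionι c) j = extensionInl c j := rfl
@[simp] lemma comp_extensionπ (c : Cochain1 M N) (j : I) :
    comp (extensionπ c) j = extensionSnd c j := rfl

/-- The sequence `0 ⟶ N ⟶ X_c ⟶ M ⟶ 0` of the extension `X_c` defined by `c`. -/
def extensionComplex (c : Cochain1 M N) : ShortComplex (Paths I ⥤ C) :=
  ShortComplex.mk (extensionι c) (extensionπ c) (hom_ext fun j => extensionInl_snd c j)

instance (c : Cochain1 M N) : Mono (extensionι c) := by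
  have (j : Paths I) : Mono ((extensionι c).app j) := inferInstanceAs (Mono (extensionInl c (show I from j)))
  exact NatTrans.mono_of_mono_app _

instance (c : Cochain1 M N) : Epi (extensionπ c) := by
  have (j : Paths I) : Epi ((extensionπ c).app j) := inferInstanceAs (Epi (extensionSnd c (show I from j)))
  exact NatTrans.epi_of_epi_app _

lemma extensionComplex_shortExact (c : Cochain1 M N) : (extensionComplex c).ShortExact where
  mono_f := inferInstanceAs (Mono (extensionι c))
  epi_g := inferInstanceAs (Epi (extensionπ c))
  exact := by
    refine ShortComplex.exact_of_f_is_kernel _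
      (KernelFork.IsLimit.ofι' (extensionι c) _ fun {A} k hk => ?_)
    have h (j : I) : (comp k j ≫ extensionFst c j) ≫ extensionInl c j = comp k j := by
      have hk' : comp k j ≫ extensionSnd c j = 0 := congr_arg (fun f : A ⟶ M => comp f j) hk
      rw [← cancel_mono (𝟙 _), ← extension_total, Preadditive.comp_add, Preadditive.comp_add,
        reassoc_of% hk', zero_comp]
      simp
    refine ⟨homMk (fun j => comp k j ≫ extensionFst c j) fun {j l} a => ?_, hom_ext h⟩
    rw [← cancel_mono (extensionInl c l), assoc, h, assoc, arr_naturality, ← comp_extensionι,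
      arr_naturality, comp_extensionι, ← assoc, h]

/-- The morphism out of the extension that is `f` on `N` and the family `s` on `M`; the hypothesis
says that `s` fails to be a morphism of representations by exactly `c` followed by `f`. -/
def extensionDesc (c : Cochain1 M N) {Y : Paths I ⥤ C} (f : N ⟶ Y)
    (s : Cochain0 M Y)
    (h : ∀ (j l : I) (a : j ⟶ l), c ⟨j, l, a⟩ ≫ comp f l + arr M a ≫ s l = s j ≫ arr Y a) :
    extension c ⟶ Y :=
  homMk (fun j => extensionFst c j ≫ comp f j + extensionSnd c j ≫ s j) fun {j l} a => by
    simp only [arr_extension, Preadditive.comp_add, Preadditive.add_comp, assoc,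
      extensionInl_fst_assoc, extensionInl_snd_assoc, extensionInr_fst_assoc,
      extensionInr_snd_assoc, comp_zero, add_zero, zero_add, ← h, arr_naturality]
    abel

lemma comp_extensionDesc (c : Cochain1 M N) {Y : Paths I ⥤ C} (f : N ⟶ Y) (s : Cochain0 M Y)
    (h : ∀ (j l : I) (a : j ⟶ l), c ⟨j, l, a⟩ ≫ comp f l + arr M a ≫ s l = s j ≫ arr Y a) (j : I) :
    comp (extensionDesc c f s h) j = extensionFst c j ≫ comp f j + extensionSnd c j ≫ s j := rfl

lemma extensionι_desc (c : Cochain1 M N) {Y : Paths I ⥤ C} (f : N ⟶ Y) (s : Cochain0 M Y)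
    (h : ∀ (j l : I) (a : j ⟶ l), c ⟨j, l, a⟩ ≫ comp f l + arr M a ≫ s l = s j ≫ arr Y a) :
    extensionι c ≫ extensionDesc c f s h = f := hom_ext fun j => by
  change comp (extensionι c) j ≫ comp (extensionDesc c f s h) j = _
  simp [comp_extensionDesc]

lemma extensionDesc_comp (c : Cochain1 M N) {Y : Paths I ⥤ C} (f : N ⟶ Y) (s : Cochain0 M Y)
    (h : ∀ (j l : I) (a : j ⟶ l), c ⟨j, l, a⟩ ≫ comp f l + arr M a ≫ s l = s j ≫ arr Y a)
    (g : Y ⟶ M) (hf : f ≫ g = 0) (hs : ∀ j, s j ≫ comp g j = 𝟙 _) :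
    extensionDesc c f s h ≫ g = extensionπ c := hom_ext fun j => by
  have hf' : comp f j ≫ comp g j = 0 := congr_arg (fun k : N ⟶ M => comp k j) hf
  change comp (extensionDesc c f s h) j ≫ comp g j = _
  simp [comp_extensionDesc, hf', hs]

section Class

open Abelian

variable [HasExt.{w} (Paths I ⥤ C)]

/-- The class in `Ext¹(M, N)` of the extension defined by `c`. -/
def extensionClass (c : Cochain1 M N) : Ext M N 1 :=
  (extensionComplex_shortExact c).extClass

/-- A family `s` of sections of the epimorphism in a short exact sequence `0 ⟶ K ⟶ Y ⟶ M ⟶ 0`,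
whose failure to commute with the arrows is `c` followed by `f : N ⟶ K`, exhibits the class of the
sequence as the pushforward of the class of `c` along `f`. -/
lemma extensionClass_comp_mk₀_eq_extClass (c : Cochain1 M N) {K Y : Paths I ⥤ C} (i : K ⟶ Y)
    (g : Y ⟶ M) (hig : i ≫ g = 0) (hS : (ShortComplex.mk i g hig).ShortExact)
    (f : N ⟶ K) (s : Cochain0 M Y) (hs : ∀ j, s j ≫ comp g j = 𝟙 _)
    (h : ∀ (j l : I) (a : j ⟶ l),
      c ⟨j, l, a⟩ ≫ comp (f ≫ i) l + arr M a ≫ s l = s j ≫ arr Y a) :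
    (extensionClass c).comp (Ext.mk₀ f) (add_zero 1) = hS.extClass := by
  let φ : extensionComplex c ⟶ ShortComplex.mk i g hig :=
    { τ₁ := f
      τ₂ := extensionDesc c (f ≫ i) s h
      τ₃ := 𝟙 M
      comm₁₂ := (extensionι_desc c _ s h).symm
      comm₂₃ := (extensionDesc_comp c _ s h g (by rw [assoc, hig, comp_zero]) hs).trans
        (comp_id _).symm }
  exact (ShortComplex.ShortExact.extClass_naturality (extensionComplex_shortExact c) hS φ).trans
    (Ext.mk₀_id_comp _)

lemma extensionClass_comp_mk₀ (c : Cochain1 M N) {N' : Paths I ⥤ C} (f : N ⟶ N') :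
    (extensionClass c).comp (Ext.mk₀ f) (add_zero 1) =
      extensionClass (N := N') fun a => c a ≫ comp f a.2.1 := by
  refine extensionClass_comp_mk₀_eq_extClass c _ _ _ _ f (extensionInr _)
    (fun j => extensionInr_snd _ j) fun j l a => ?_
  change _ ≫ comp f l ≫ comp (extensionι _) l + _ = _
  simp [arr_extension]

/-- Additivity follows from functoriality: both classes and their sum are pushforwards of the class
of a single cocycle with values in `N ⊞ N`. -/
lemma extensionClass_add (c c' : Cochain1 M N) :
    extensionClass (c + c') = extensionClass c + extensionClass c' := by
  let C : Cochain1 M (N ⊞ N) := fun a =>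
    c a ≫ comp biprod.inl a.2.1 + c' a ≫ comp biprod.inr a.2.1
  have h (f : N ⊞ N ⟶ N) : (extensionClass C).comp (Ext.mk₀ f) (add_zero 1) =
      extensionClass fun a => c a ≫ comp (biprod.inl ≫ f) a.2.1 +
        c' a ≫ comp (biprod.inr ≫ f) a.2.1 := by
    rw [extensionClass_comp_mk₀]
    congr 1
    ext a
    change (c a ≫ comp biprod.inl a.2.1 + c' a ≫ comp biprod.inr a.2.1) ≫ _ =
      c a ≫ comp biprod.inl a.2.1 ≫ comp f a.2.1 + c' a ≫ comp biprod.inr a.2.1 ≫ comp f a.2.1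
    simp
  have h1 := h biprod.fst
  have h2 := h biprod.snd
  have h3 := h (biprod.fst + biprod.snd)
  simp only [Preadditive.comp_add, biprod.inl_fst, biprod.inr_fst, biprod.inl_snd,
    biprod.inr_snd, add_zero, zero_add, Ext.mk₀_add, Ext.comp_add] at h1 h2 h3
  rw [h1, h2] at h3
  have e0 (a : Σ j l : I, (j ⟶ l)) : comp (0 : N ⟶ N) a.2.1 = 0 := rfl
  have e1 (a : Σ j l : I, (j ⟶ l)) : comp (𝟙 N) a.2.1 = 𝟙 _ := rfl
  simp only [e0, e1, comp_id, comp_zero, add_zero, zero_add] at h3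
  exact h3.symm

lemma extensionClass_smul {R : Type*} [CommRing R] [Linear R C] (r : R) (c : Cochain1 M N) :
    extensionClass (r • c) = r • extensionClass c := by
  rw [Ext.smul_eq_comp_mk₀, extensionClass_comp_mk₀]
  congr 1
  ext a
  have : comp (r • 𝟙 N) a.2.1 = r • 𝟙 _ := rfl
  simp [this]

/-- The coboundary of a family `h`; it measures the failure of `h` to commute with the arrows. -/
@[simps]
def differential (R : Type*) [CommRing R] [Linear R C] (M N : Paths I ⥤ C) :
    Cochain0 M N →ₗ[R] Cochain1 M N where
  toFun h a := h a.1 ≫ arr N a.2.2 - arr M a.2.2 ≫ h a.2.1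
  map_add' h h' := by ext a; simp; abel
  map_smul' r h := by ext a; simp [smul_sub]

lemma extensionClass_eq_zero_iff (R : Type*) [CommRing R] [Linear R C] (c : Cochain1 M N) :
    extensionClass c = 0 ↔ c ∈ LinearMap.range (differential R M N) := by
  constructor
  · intro hc
    obtain ⟨x, hx⟩ := Ext.contravariant_sequence_exact₁ (extensionComplex_shortExact c) N
      (Ext.mk₀ (𝟙 N)) (add_zero 1) ((Ext.comp_mk₀_id _).trans hc)
    obtain ⟨r, rfl⟩ := (Ext.mk₀_bijective _ _).2 x
    let r' : extension c ⟶ N := r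
    have hr : extensionι c ≫ r' = 𝟙 N :=
      (Ext.mk₀_bijective _ _).1 ((Ext.mk₀_comp_mk₀ _ _).symm.trans hx)
    refine ⟨fun j => extensionInr c j ≫ comp r' j, ?_⟩
    ext ⟨j, l, a⟩
    have hr' : extensionInl c l ≫ comp r' l = 𝟙 _ := congr_arg (fun k : N ⟶ N => comp k l) hr
    have := extensionInr c j ≫= arr_naturality r' a
    rw [arr_extension] at this
    simp [hr'] at this
    simp [← this]
  · rintro ⟨h, rfl⟩
    let r := extensionDesc (differential R M N h) (𝟙 N) h fun j l a => by
      simp only [differential_apply]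
      change _ ≫ 𝟙 _ + _ = _
      simp
    have hr : extensionι _ ≫ r = 𝟙 N := extensionι_desc _ _ _ _
    have := (extensionComplex_shortExact (differential R M N h)).extClass_comp_assoc
      (Ext.mk₀ r) (h := add_zero 1)
    have h0 : (Ext.mk₀ (extensionComplex (differential R M N h)).f).comp (Ext.mk₀ r) (add_zero 0) =
        Ext.mk₀ (𝟙 N) := (Ext.mk₀_comp_mk₀ _ _).trans (congr_arg _ hr)
    rw [h0] at this
    exact (Ext.comp_mk₀_id _).symm.trans this

/-- If every object of `C` is projective, a short exact sequence of representations splits at each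
vertex, and the splittings define a cocycle; effaceability reduces every class to such
sequences. -/
lemma extensionClass_surjective (hC : ∀ X : C, Projective X) (e : Ext M N 1) :
    ∃ c : Cochain1 M N, extensionClass c = e := by
  obtain ⟨P, p, hp, he⟩ := Ext.exists_epi_mk₀_comp_eq_zero e
  have hS : (ShortComplex.mk _ _ (kernel.condition p)).ShortExact :=
    { exact := ShortComplex.exact_kernel p }
  obtain ⟨x, rfl⟩ := Ext.contravariant_sequence_exact₃ hS N e he (add_zero 1)
  obtain ⟨f, rfl⟩ := (Ext.mk₀_bijective _ _).2 x
  have := hC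
  let σ (j : I) := (hS.map_of_exact ((evaluation (Paths I) C).obj
    ((Paths.of I).obj j))).splittingOfProjective
  let s (j : I) : vtx M j ⟶ vtx P j := (σ j).s
  let r (j : I) : vtx P j ⟶ vtx (kernel p) j := (σ j).r
  have hs (j : I) : s j ≫ comp p j = 𝟙 _ := (σ j).s_g
  have hr (j : I) : r j ≫ comp (kernel.ι p) j = 𝟙 _ - comp p j ≫ s j := (σ j).r_f
  let c : Cochain1 M (kernel p) := fun a => s a.1 ≫ arr P a.2.2 ≫ r a.2.1
  refine ⟨fun a => c a ≫ comp f a.2.1, ?_⟩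
  rw [← extensionClass_comp_mk₀]
  congr 1
  refine (Ext.comp_mk₀_id _).symm.trans ?_
  refine extensionClass_comp_mk₀_eq_extClass c (kernel.ι p) p _ hS (𝟙 _) s hs fun j l a => ?_
  rw [id_comp]
  simp only [c, assoc, hr, Preadditive.comp_sub, comp_id]
  rw [← assoc (arr P a), arr_naturality, assoc, ← assoc (s j), hs, id_comp]
  abel

end Class

end CategoryTheory.Paths

end Extensions

/-! ### The Euler form -/

section Euler

open Limits Category Abelian Module

namespace CategoryTheory.Paths

variable {C : Type u} [Category.{v} C] [Abelian C] {I : Type u'} [Quiver.{v'} I]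
  (R : Type*) [CommRing R] [Linear R C] (M N : Paths I ⥤ C)

/-- The extension class as a linear map in the cocycle. -/
def extensionClassLinear [HasExt.{w} (Paths I ⥤ C)] :
    Cochain1 M N →ₗ[R] Ext M N 1 where
  toFun := extensionClass
  map_add' := extensionClass_add
  map_smul' := extensionClass_smul

/-- Morphisms of representations are the families with vanishing coboundary. -/
def homEquivKer : (M ⟶ N) ≃ₗ[R] LinearMap.ker (differential R M N) where
  toFun f := ⟨fun j => comp f j, by
    rw [LinearMap.mem_ker]
    ext a
    exact sub_eq_zero.2 (arr_naturality f a.2.2).symm⟩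
  map_add' _ _ := rfl
  map_smul' _ _ := rfl
  invFun h := homMk h.1 fun {j l} a =>
    (sub_eq_zero.1 (congr_fun (LinearMap.mem_ker.1 h.2) ⟨j, l, a⟩)).symm
  left_inv _ := rfl
  right_inv _ := rfl

variable {M N}

variable {k : Type*} [Field k] [Linear k C] [HasExt.{w} (Paths I ⥤ C)]

lemma extensionClassLinear_surjective (hC : ∀ X : C, Projective X) :
    Function.Surjective (extensionClassLinear k M N) := extensionClass_surjective hC

variable [∀ X Y : C, Module.Finite k (X ⟶ Y)] [Fintype I] [Fintype (Σ j l : I, (j ⟶ l))]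

lemma finite_ext_one (hC : ∀ X : C, Projective X) : Module.Finite k (Ext M N 1) :=
  .of_surjective (extensionClassLinear k M N) (extensionClassLinear_surjective hC)

/-- Ringel's formula: `dim Hom(M, N) - dim Ext¹(M, N)` equals the number
`∑_j dim Hom(M_j, N_j) - ∑_{a : j → l} dim Hom(M_j, N_l)`. -/
lemma finrank_ext_one_add (hC : ∀ X : C, Projective X) :
    finrank k (Ext M N 1) + ∑ j : I, finrank k (vtx M j ⟶ vtx N j) =
      finrank k (M ⟶ N) +
        ∑ a : Σ j l : I, (j ⟶ l), finrank k (vtx M a.1 ⟶ vtx N a.2.1) := by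
  have h1 := (differential k M N).finrank_range_add_finrank_ker
  have h2 := (extensionClassLinear k M N).finrank_range_add_finrank_ker
  have h3 : LinearMap.ker (extensionClassLinear k M N) = LinearMap.range (differential k M N) := by
    ext c
    exact extensionClass_eq_zero_iff k c
  rw [LinearMap.range_eq_top.2 (extensionClassLinear_surjective hC), finrank_top, h3,
    Module.finrank_pi_fintype] at h2
  rw [Module.finrank_pi_fintype] at h1
  rw [(homEquivKer k M N).finrank_eq]
  lia

end CategoryTheory.Paths

end Euler

section FG
open Module Limits
variable {k : Type u} [Field k]

instance FGModuleCat.projective (X : FGModuleCat.{v} k) : Projective X where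
  factors {E Y} f e _ := by
    have he : Function.Surjective e.hom.hom := by
      have : Epi ((forget₂ (FGModuleCat k) (ModuleCat k)).map e) := inferInstance
      exact (ModuleCat.epi_iff_surjective _).1 this
    obtain ⟨g, hg⟩ := Module.projective_lifting_property e.hom.hom f.hom.hom he
    exact ⟨FGModuleCat.ofHom g, FGModuleCat.hom_ext hg⟩

/-- Morphisms in `FGModuleCat k` are linear maps. -/
def FGModuleCat.homEquiv (X Y : FGModuleCat.{v} k) : (X ⟶ Y) ≃ₗ[k] (X →ₗ[k] Y) where
  toFun f := f.hom.hom
  map_add' _ _ := rfl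
  map_smul' _ _ := rfl
  invFun f := FGModuleCat.ofHom f
  left_inv _ := rfl
  right_inv _ := rfl

end FG

section QR
open Module
variable {k : Type u} [Field k] {I : Type u} [Quiver.{u} I] [Fintype I] [Fintype (Σ j l : I, (j ⟶ l))]

instance QuiverRep.finite_ext1 (M N : QuiverRep k I) : Module.Finite k (M.Ext1 N) :=
  letI := HasExt.standard (QuiverRep k I)
  Paths.finite_ext_one inferInstance

lemma QuiverRep.finrank_ext1_add (M N : QuiverRep k I) :
    finrank k (M.Ext1 N) + ∑ j : I, finrank k (M.space j) * finrank k (N.space j) =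
      finrank k (M ⟶ N) +
        ∑ a : Σ j l : I, (j ⟶ l), finrank k (M.space a.1) * finrank k (N.space a.2.1) := by
  let := HasExt.standard (QuiverRep k I)
  have := Paths.finrank_ext_one_add (k := k) (M := M) (N := N) inferInstance
  simp only [(FGModuleCat.homEquiv _ _).finrank_eq, finrank_linearMap] at this
  exact this
end QR

/-! ### Linear algebra -/

section LinAlg

open Module

variable {k : Type*} [Field k] {X X' P P' V W : Type*}
  [AddCommGroup X] [Module k X] [AddCommGroup X'] [Module k X']
  [AddCommGroup P] [Module k P] [AddCommGroup P'] [Module k P']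
  [AddCommGroup V] [Module k V] [AddCommGroup W] [Module k W]

lemma LinearMap.exists_comp_eq_iff_range_le (ν : X' →ₗ[k] P) (h : X →ₗ[k] P) :
    (∃ g : X →ₗ[k] X', ν ∘ₗ g = h) ↔ LinearMap.range h ≤ LinearMap.range ν := by
  refine ⟨?_, fun hle => ?_⟩
  · rintro ⟨g, rfl⟩
    exact LinearMap.range_comp_le_range _ _
  · obtain ⟨g, hg⟩ := Module.projective_lifting_property ν.rangeRestrict
      (h.codRestrict _ fun x => hle ⟨x, rfl⟩) ν.surjective_rangeRestrict
    exact ⟨g, LinearMap.ext fun x => congr_arg Subtype.val (LinearMap.congr_fun hg x)⟩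

lemma LinearMap.exists_comp_eq_iff_ker_le (π : P →ₗ[k] X) (h : P →ₗ[k] X') :
    (∃ g : X →ₗ[k] X', g ∘ₗ π = h) ↔ LinearMap.ker π ≤ LinearMap.ker h := by
  refine ⟨?_, fun hle => ?_⟩
  · rintro ⟨g, rfl⟩
    exact LinearMap.ker_le_ker_comp _ _
  · obtain ⟨s, hs⟩ := π.rangeRestrict.exists_rightInverse_of_surjective π.range_rangeRestrict
    obtain ⟨g, hg⟩ := LinearMap.exists_extend (h ∘ₗ s)
    refine ⟨g, LinearMap.ext fun x => ?_⟩
    have h1 : g (π x) = h (s (π.rangeRestrict x)) := LinearMap.congr_fun hg (π.rangeRestrict x)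
    have h2 : π (s (π.rangeRestrict x)) = π x :=
      congr_arg Subtype.val (LinearMap.congr_fun hs (π.rangeRestrict x))
    have h3 : s (π.rangeRestrict x) - x ∈ LinearMap.ker h :=
      hle (by rw [LinearMap.mem_ker, map_sub, h2, sub_self])
    rw [LinearMap.mem_ker, map_sub, sub_eq_zero] at h3
    exact h1.trans h3

/-- A map `F : P → P'` extends to a commutative square with the maps `μ`, `μ'` into `P`, `P'` if and
only if it extends to one with the maps from `P`, `P'` to the cokernels of `μ`, `μ'`: both say that
`F` maps the image of `μ` into that of `μ'`. -/
lemma exists_comp_eq_comp_iff_coker (μ : X →ₗ[k] P) (μ' : X' →ₗ[k] P') (F : P →ₗ[k] P') :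
    (∃ g : X →ₗ[k] X', μ' ∘ₗ g = F ∘ₗ μ) ↔
      ∃ g : ((P ⧸ LinearMap.range μ) × V) →ₗ[k] ((P' ⧸ LinearMap.range μ') × W),
        g ∘ₗ (LinearMap.inl k _ V ∘ₗ (LinearMap.range μ).mkQ) =
          (LinearMap.inl k _ W ∘ₗ (LinearMap.range μ').mkQ) ∘ₗ F := by
  rw [LinearMap.exists_comp_eq_iff_range_le, LinearMap.exists_comp_eq_iff_ker_le,
    LinearMap.ker_comp_of_ker_eq_bot _ (LinearMap.ker_eq_bot.2 LinearMap.inl_injective), Submodule.ker_mkQ, LinearMap.comp_assoc,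
    LinearMap.ker_comp_of_ker_eq_bot _ (LinearMap.ker_eq_bot.2 LinearMap.inl_injective), LinearMap.ker_comp, Submodule.ker_mkQ,
    LinearMap.range_comp, Submodule.map_le_iff_le_comap]

/-- A map `F : P → P'` extends to a commutative square with the maps `ν`, `ν'` out of `P`, `P'` if
and only if it extends to one with the maps from the kernels of `ν`, `ν'` to `P`, `P'`: both say that
`F` maps the kernel of `ν` into that of `ν'`. -/
lemma exists_comp_eq_comp_iff_ker (ν : P →ₗ[k] X) (ν' : P' →ₗ[k] X') (F : P →ₗ[k] P') :
    (∃ g : X →ₗ[k] X', g ∘ₗ ν = ν' ∘ₗ F) ↔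
      ∃ g : (LinearMap.ker ν × V) →ₗ[k] (LinearMap.ker ν' × W),
        ((LinearMap.ker ν').subtype ∘ₗ LinearMap.fst k _ W) ∘ₗ g =
          F ∘ₗ ((LinearMap.ker ν).subtype ∘ₗ LinearMap.fst k _ V) := by
  rw [LinearMap.exists_comp_eq_iff_range_le, LinearMap.exists_comp_eq_iff_ker_le,
    LinearMap.range_comp_of_range_eq_top _ (LinearMap.range_eq_top.2 LinearMap.fst_surjective), Submodule.range_subtype,
    ← LinearMap.comp_assoc,
    LinearMap.range_comp_of_range_eq_top _ (LinearMap.range_eq_top.2 LinearMap.fst_surjective), LinearMap.range_comp,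
    Submodule.range_subtype, Submodule.map_le_iff_le_comap, LinearMap.ker_comp]

lemma finrank_ker_postcomp [FiniteDimensional k X] [FiniteDimensional k X']
    (μ : X' →ₗ[k] P) :
    finrank k (LinearMap.ker (LinearMap.compRight k μ : (X →ₗ[k] X') →ₗ[k] X →ₗ[k] P)) =
      finrank k X * finrank k (LinearMap.ker μ) := by
  rw [← finrank_linearMap (S := k)]
  refine LinearEquiv.finrank_eq
    { toFun := fun g => g.1.codRestrict _ fun x => LinearMap.congr_fun g.2 x
      map_add' := fun _ _ => rfl
      map_smul' := fun _ _ => rfl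
      invFun := fun g => ⟨(LinearMap.ker μ).subtype ∘ₗ g, LinearMap.ext fun x => (g x).2⟩
      left_inv := fun _ => rfl
      right_inv := fun _ => rfl }

lemma finrank_ker_precomp_add [FiniteDimensional k X] [FiniteDimensional k X']
    (π : P →ₗ[k] X) :
    finrank k (LinearMap.ker (LinearMap.lcomp k X' π)) +
      finrank k (LinearMap.range π) * finrank k X' = finrank k X * finrank k X' := by
  have h : finrank k (LinearMap.ker (LinearMap.lcomp k X' π)) =
      finrank k ((X ⧸ LinearMap.range π) →ₗ[k] X') :=
    LinearEquiv.finrank_eq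
    { toFun := fun g => (LinearMap.range π).liftQ g.1 (by
        rintro _ ⟨x, rfl⟩
        exact LinearMap.congr_fun g.2 x)
      map_add' := fun _ _ => by ext; rfl
      map_smul' := fun _ _ => by ext; rfl
      invFun := fun g => ⟨g ∘ₗ (LinearMap.range π).mkQ, LinearMap.ext fun x =>
        (congr_arg g ((Submodule.Quotient.mk_eq_zero _).2 ⟨x, rfl⟩)).trans (map_zero g)⟩
      left_inv := fun _ => rfl
      right_inv := fun _ => by ext; rfl }
  rw [h, finrank_linearMap, ← add_mul, Submodule.finrank_quotient_add_finrank]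

/-- The dimension of the space of pairs `(g, u)` with `u ∈ K` and `β g = α u`, computed by
projecting to `u`. -/
lemma finrank_pullback {G U T : Type*} [AddCommGroup G] [Module k G] [AddCommGroup U]
    [Module k U] [AddCommGroup T] [Module k T] [FiniteDimensional k G] [FiniteDimensional k U]
    (K : Submodule k U) (α : U →ₗ[k] T) (β : G →ₗ[k] T) :
    finrank k (K.comap (LinearMap.snd k G U) ⊓
        LinearMap.ker (β ∘ₗ LinearMap.fst k G U - α ∘ₗ LinearMap.snd k G U) : Submodule k (G × U)) =
      finrank k (K ⊓ (LinearMap.range β).comap α : Submodule k U) + finrank k (LinearMap.ker β) := by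
  set S := (K.comap (LinearMap.snd k G U) ⊓
        LinearMap.ker (β ∘ₗ LinearMap.fst k G U - α ∘ₗ LinearMap.snd k G U) : Submodule k (G × U))
  have hS (p : G × U) : p ∈ S ↔ p.2 ∈ K ∧ β p.1 = α p.2 := by
    simp [S, sub_eq_zero]
  let r : S →ₗ[k] U := LinearMap.snd k G U ∘ₗ S.subtype
  have h := r.finrank_range_add_finrank_ker
  have h1 : LinearMap.range r = K ⊓ (LinearMap.range β).comap α := by
    ext u
    constructor
    · rintro ⟨p, rfl⟩
      exact ⟨((hS _).1 p.2).1, p.1.1, ((hS _).1 p.2).2⟩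
    · rintro ⟨hu, g, hg⟩
      exact ⟨⟨(g, u), (hS _).2 ⟨hu, hg⟩⟩, rfl⟩
  have h2 : finrank k (LinearMap.ker r) = finrank k (LinearMap.ker β) :=
    LinearEquiv.finrank_eq
    { toFun := fun p => ⟨p.1.1.1, by
        have hp : p.1.1.2 = 0 := p.2
        rw [LinearMap.mem_ker, ((hS _).1 p.1.2).2, hp, map_zero]⟩
      map_add' := fun _ _ => rfl
      map_smul' := fun _ _ => rfl
      invFun := fun g => ⟨⟨(g.1, 0), (hS _).2 ⟨K.zero_mem, by simp⟩⟩, rfl⟩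
      left_inv := fun p => Subtype.ext (Subtype.ext (Prod.ext rfl (Eq.symm p.2)))
      right_inv := fun _ => rfl }
  rw [← h, h1, h2]

end LinAlg

/-! ### Morphisms of representations, split at a vertex -/

section Split
open Module

variable {k : Type u} [Field k] {I : Type u} [DecidableEq I]

/-- A family of morphisms splits into its member at `i` and the family of the others; both are
transported along given isomorphisms and turned into linear maps. -/
def splitHom (S S' : I → FGModuleCat.{u} k) (i : I) {X X' : FGModuleCat.{u} k}
    {P P' : {j : I // j ≠ i} → FGModuleCat.{u} k} (e₀ : S i ≅ X) (e₀' : S' i ≅ X')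
    (e : ∀ j : {j : I // j ≠ i}, S j ≅ P j) (e' : ∀ j : {j : I // j ≠ i}, S' j ≅ P' j) :
    ((j : I) → (S j ⟶ S' j)) ≃ₗ[k]
      (X →ₗ[k] X') × ((j : {j : I // j ≠ i}) → (P j →ₗ[k] P' j)) :=
  ({ Equiv.piSplitAt i (fun j => S j ⟶ S' j) with
      map_add' := fun _ _ => rfl
      map_smul' := fun _ _ => rfl } : ((j : I) → (S j ⟶ S' j)) ≃ₗ[k]
        (S i ⟶ S' i) × ((j : {j : I // j ≠ i}) → (S j ⟶ S' j))) ≪≫ₗ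
    LinearEquiv.prodCongr (Linear.homCongr k e₀ e₀' ≪≫ₗ FGModuleCat.homEquiv _ _)
      (LinearEquiv.piCongrRight fun j => Linear.homCongr k (e j) (e' j) ≪≫ₗ
        FGModuleCat.homEquiv _ _)

/-- Commutation of a square can be tested after replacing its corners by isomorphic objects. -/
lemma iso_conj_naturality_iff {X Y X' Y' X₁ Y₁ X₁' Y₁' : FGModuleCat.{u} k}
    (α : X ≅ X₁) (β : Y ≅ Y₁) (α' : X' ≅ X₁') (β' : Y' ≅ Y₁') (a : X₁ ⟶ Y₁) (a' : X₁' ⟶ Y₁')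
    (f : X ⟶ X') (g : Y ⟶ Y') :
    (α.hom ≫ a ≫ β.inv) ≫ g = f ≫ α'.hom ≫ a' ≫ β'.inv ↔
      ((β.inv ≫ g) ≫ β'.hom).hom.hom ∘ₗ a.hom.hom =
        a'.hom.hom ∘ₗ ((α.inv ≫ f) ≫ α'.hom).hom.hom := by
  rw [← cancel_epi α.inv, ← cancel_mono β'.hom]
  have h (u v : X₁ ⟶ Y₁') : u = v ↔ u.hom.hom = v.hom.hom :=
    ⟨fun h => by rw [h], FGModuleCat.hom_ext⟩
  rw [h]
  simp only [Category.assoc, Iso.inv_hom_id_assoc, Iso.inv_hom_id, Category.comp_id]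
  rfl

/-- The dimension of `Hom(R, R')` when, after splitting off a vertex, commutation with the arrows
means that the second component lies in `K` and that the pair satisfies one linear equation. -/
lemma finrank_hom_eq_of_split {Q : Type u} [Quiver.{u} Q] [Fintype Q] (R R' : QuiverRep k Q)
    {G U T : Type*}
    [AddCommGroup G] [Module k G] [AddCommGroup U] [Module k U] [AddCommGroup T] [Module k T]
    [FiniteDimensional k G] [FiniteDimensional k U]
    (Ψ : Paths.Cochain0 R R' ≃ₗ[k] G × U) (K : Submodule k U) (α : U →ₗ[k] T) (β : G →ₗ[k] T)
    (h : ∀ f : Paths.Cochain0 R R',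
      (∀ (j l : Q) (a : j ⟶ l), Paths.arr R a ≫ f l = f j ≫ Paths.arr R' a) ↔
        (Ψ f).2 ∈ K ∧ β (Ψ f).1 = α (Ψ f).2) :
    finrank k (R ⟶ R') = finrank k (K ⊓ (LinearMap.range β).comap α : Submodule k U) +
      finrank k (LinearMap.ker β) := by
  rw [← finrank_pullback, (Paths.homEquivKer k R R').finrank_eq]
  refine ((Ψ.ofSubmodule' _).symm.trans (LinearEquiv.ofEq _ _ ?_)).symm.finrank_eq
  ext f
  rw [LinearMap.mem_ker]
  refine Iff.trans ?_ (Iff.trans (h f).symm ?_)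
  · simp [sub_eq_zero]
  · constructor
    · intro h
      exact funext fun ⟨j, l, a⟩ => sub_eq_zero.2 (h j l a).symm
    · intro h j l a
      exact (sub_eq_zero.1 (congr_fun h ⟨j, l, a⟩)).symm

end Split

section Away

open Module

variable {k : Type u} [Field k] {I : Type u} [Quiver.{u} I]

/-- Families of linear maps `M_j → N_j` at the vertices different from `i`. -/
abbrev AwayHom (M N : QuiverRep k I) (i : I) : Type u :=
  (j : {j : I // j ≠ i}) → (M.space j →ₗ[k] N.space j)

/-- The arrows that do not touch `i`. -/
abbrev KeptArrow (i : I) : Type u := Σ j l : {j : I // j ≠ i}, (j.1 ⟶ l.1)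

/-- The families that commute with all arrows that do not touch `i`. -/
def keptSubmodule (M N : QuiverRep k I) (i : I) : Submodule k (AwayHom M N i) where
  carrier := {f | ∀ (j l : {j : I // j ≠ i}) (a : j.1 ⟶ l.1),
    f l ∘ₗ M.arrowMap a = N.arrowMap a ∘ₗ f j}
  zero_mem' _ _ _ := by simp
  add_mem' {f g} hf hg j l a := by
    simp [LinearMap.add_comp, LinearMap.comp_add, hf j l a, hg j l a]
  smul_mem' c f hf j l a := by
    simp [LinearMap.smul_comp, LinearMap.comp_smul, hf j l a]

/-- The map between products of the spaces of `M` and `N` at vertices `ι a`, acting on the factor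
with index `a` by the member `f (ι a)` of a family `f`. -/
def diagHom (M N : QuiverRep k I) (i : I) {A : Type u} (ι : A → {j : I // j ≠ i}) :
    AwayHom M N i →ₗ[k] ((a : A) → M.space (ι a)) →ₗ[k] ((a : A) → N.space (ι a)) where
  toFun f := LinearMap.pi fun a => f (ι a) ∘ₗ LinearMap.proj a
  map_add' _ _ := rfl
  map_smul' _ _ := rfl

lemma diagHom_comp_single (M N : QuiverRep k I) (i : I) {A : Type u} [DecidableEq A]
    (ι : A → {j : I // j ≠ i}) (f : AwayHom M N i) (a : A) :
    diagHom M N i ι f ∘ₗ LinearMap.single k (fun a => M.space (ι a)) a =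
      LinearMap.single k (fun a => N.space (ι a)) a ∘ₗ f (ι a) :=
  LinearMap.ext fun x => funext fun b =>
    Pi.apply_single (fun b => f (ι b)) (fun b => map_zero (f (ι b))) a x b

variable {i : I}

/-- The target of an arrow that starts at the source `i`. -/
def IsQuiverSource.outVertex (hi : IsQuiverSource i) (a : Σ l : I, (i ⟶ l)) : {j : I // j ≠ i} :=
  ⟨a.1, hi.ne a.2⟩

/-- The starting vertex of an arrow that ends at the sink `i`. -/
def IsQuiverSink.inVertex (hi : IsQuiverSink i) (a : Σ l : I, (l ⟶ i)) : {j : I // j ≠ i} :=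
  ⟨a.1, hi.ne a.2⟩

lemma IsQuiverSource.target_ne (hi : IsQuiverSource i) {j l : I} (a : j ⟶ l) : l ≠ i := by
  rintro rfl
  exact (hi _).false a

lemma IsQuiverSink.source_ne (hi : IsQuiverSink i) {j l : I} (a : j ⟶ l) : j ≠ i := by
  rintro rfl
  exact (hi _).false a

variable [Fintype I] [DecidableEq I] [∀ j l : I, Fintype (j ⟶ l)]

/-- The sum of `dim M_j * dim N_j` over the vertices `j` different from `i`. -/
def awaySum (M N : QuiverRep k I) (i : I) : ℕ :=
  ∑ j : {j : I // j ≠ i}, finrank k (M.space j) * finrank k (N.space j)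

/-- The sum of `dim M_j * dim N_l` over the arrows `j ⟶ l` that do not touch `i`. -/
def keptSum (M N : QuiverRep k I) (i : I) : ℕ :=
  ∑ a : KeptArrow i, finrank k (M.space a.1) * finrank k (N.space a.2.1)

/-- The arrows of a quiver with a source `i`: those not touching `i`, and those starting at `i`. -/
def IsQuiverSource.arrowEquiv (hi : IsQuiverSource i) :
    KeptArrow i ⊕ (Σ l : I, (i ⟶ l)) ≃ Σ j l : I, (j ⟶ l) :=
  Equiv.ofBijective
    (Sum.elim (fun a => ⟨a.1.1, a.2.1.1, a.2.2⟩) (fun a => ⟨i, a.1, a.2⟩)) (by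
    constructor
    · rintro (⟨⟨j, hj⟩, ⟨l, hl⟩, a⟩ | ⟨l, a⟩) (⟨⟨j', hj'⟩, ⟨l', hl'⟩, a'⟩ | ⟨l', a'⟩) h
      · cases h; rfl
      · exact (hj (congr_arg (fun x => x.1) h)).elim
      · exact (hj' (congr_arg (fun x => x.1) h).symm).elim
      · cases h; rfl
    · rintro ⟨j, l, a⟩
      rcases eq_or_ne j i with rfl | hj
      · exact ⟨Sum.inr ⟨l, a⟩, rfl⟩
      · exact ⟨Sum.inl ⟨⟨j, hj⟩, ⟨l, hi.target_ne a⟩, a⟩, rfl⟩)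

/-- The arrows of the reflection at a source `i`: the kept ones, and the reversals of the arrows
that start at `i`. -/
def IsQuiverSource.reflectedArrowEquiv (hi : IsQuiverSource i) :
    KeptArrow i ⊕ (Σ l : I, (i ⟶ l)) ≃ Σ j l : Reflected i, (j ⟶ l) :=
  Equiv.ofBijective
    (Sum.elim (fun a => ⟨a.1.1, a.2.1.1, ReflectedHom.keep a.1.2 a.2.1.2 a.2.2⟩)
      (fun a => ⟨a.1, i, ReflectedHom.revOut a.2⟩)) (by
    constructor
    · rintro (⟨⟨j, hj⟩, ⟨l, hl⟩, a⟩ | ⟨l, a⟩) (⟨⟨j', hj'⟩, ⟨l', hl'⟩, a'⟩ | ⟨l', a'⟩) h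
      · cases h; rfl
      · exact (hl (congr_arg (fun x => x.2.1) h)).elim
      · exact (hl' (congr_arg (fun x => x.2.1) h).symm).elim
      · cases h; rfl
    · rintro ⟨j, l, ⟨hj, hl, a⟩ | ⟨a⟩ | ⟨a⟩⟩
      · exact ⟨Sum.inl ⟨⟨j, hj⟩, ⟨l, hl⟩, a⟩, rfl⟩
      · exact ⟨Sum.inr ⟨_, a⟩, rfl⟩
      · exact ((hi _).false a).elim)

instance : Fintype (Reflected i) := ‹Fintype I›

lemma IsQuiverSource.finrank_hom (hi : IsQuiverSource i) (M N : QuiverRep k I) :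
    finrank k (M ⟶ N) =
      finrank k (keptSubmodule M N i ⊓ (LinearMap.range (LinearMap.compRight k (N.outMap i) :
        (M.space i →ₗ[k] N.space i) →ₗ[k] _)).comap
          (LinearMap.lcomp k _ (M.outMap i) ∘ₗ diagHom M N i hi.outVertex) :
            Submodule k (AwayHom M N i)) +
      finrank k (M.space i) * finrank k (LinearMap.ker (N.outMap i)) := by
  rw [← finrank_ker_postcomp]
  refine finrank_hom_eq_of_split M N (splitHom (fun j => M.space j) (fun j => N.space j) i
    (Iso.refl _) (Iso.refl _) (fun j => Iso.refl _) (fun j => Iso.refl _)) _ _ _ fun f => ?_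
  have key {j l : I} (a : j ⟶ l) := iso_conj_naturality_iff (Iso.refl _) (Iso.refl _)
    (Iso.refl _) (Iso.refl _) (Paths.arr M a) (Paths.arr N a) (f j) (f l)
  simp only [Iso.refl_hom, Iso.refl_inv, Category.id_comp, Category.comp_id] at key
  constructor
  · intro h
    refine ⟨fun j l a => ?_, ?_⟩
    · exact (key a).1 (h _ _ a)
    · refine LinearMap.ext fun x => funext fun a => ?_
      exact (LinearMap.congr_fun ((key a.2).1 (h _ _ a.2)) x).symm
  · rintro ⟨h1, h2⟩ j l a
    rw [key a]
    rcases eq_or_ne j i with rfl | hj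
    · exact LinearMap.ext fun x => (congr_fun (LinearMap.congr_fun h2 x) ⟨l, a⟩).symm
    · exact h1 ⟨j, hj⟩ ⟨l, hi.target_ne a⟩ a

end Away

/-! ### Morphisms between reflected representations -/

section Source

open Module

variable {k : Type u} [Field k] {I : Type u} [Quiver.{u} I] [DecidableEq I] {i : I}

/-- The replaced space at `i`, as a space of the new representation. -/
def replaceSourceIsoSelf (hi : IsQuiverSource i) (M : QuiverRep k I) (X : FGModuleCat.{u} k)
    (φ : ∀ a : Σ l : I, (i ⟶ l), M.space a.1 ⟶ X) :
    (M.replaceSource hi X φ).space (I := Reflected i) i ≅ X :=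
  eqToIso (M.replace_self X)

/-- The spaces at vertices different from `i` are unchanged. -/
def replaceSourceIso (hi : IsQuiverSource i) (M : QuiverRep k I) (X : FGModuleCat.{u} k)
    (φ : ∀ a : Σ l : I, (i ⟶ l), M.space a.1 ⟶ X) {j : I} (hj : j ≠ i) :
    (M.replaceSource hi X φ).space (I := Reflected i) j ≅ M.space j :=
  eqToIso (M.replace_of_ne X hj)

lemma arr_replaceSource_keep (hi : IsQuiverSource i) (M : QuiverRep k I) (X : FGModuleCat.{u} k)
    (φ : ∀ a : Σ l : I, (i ⟶ l), M.space a.1 ⟶ X) {j l : I} (hj : j ≠ i) (hl : l ≠ i)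
    (a : j ⟶ l) :
    Paths.arr (I := Reflected i) (j := j) (l := l) (M.replaceSource hi X φ)
        (ReflectedHom.keep hj hl a) =
      (replaceSourceIso hi M X φ hj).hom ≫ Paths.arr M a ≫ (replaceSourceIso hi M X φ hl).inv :=
  Paths.arr_lift _ _

lemma arr_replaceSource_revOut (hi : IsQuiverSource i) (M : QuiverRep k I) (X : FGModuleCat.{u} k)
    (φ : ∀ a : Σ l : I, (i ⟶ l), M.space a.1 ⟶ X) {l : I} (a : i ⟶ l) :
    Paths.arr (I := Reflected i) (j := l) (l := i) (M.replaceSource hi X φ)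
        (ReflectedHom.revOut a) =
      (replaceSourceIso hi M X φ (hi.ne a)).hom ≫ φ ⟨l, a⟩ ≫
        (replaceSourceIsoSelf hi M X φ).inv :=
  Paths.arr_lift _ _

/-- The replaced space at `i`, as a space of the new representation. -/
def replaceSinkIsoSelf (hi : IsQuiverSink i) (M : QuiverRep k I) (X : FGModuleCat.{u} k)
    (φ : ∀ a : Σ j : I, (j ⟶ i), X ⟶ M.space a.1) :
    (M.replaceSink hi X φ).space (I := Reflected i) i ≅ X :=
  eqToIso (M.replace_self X)

/-- The spaces at vertices different from `i` are unchanged. -/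
def replaceSinkIso (hi : IsQuiverSink i) (M : QuiverRep k I) (X : FGModuleCat.{u} k)
    (φ : ∀ a : Σ j : I, (j ⟶ i), X ⟶ M.space a.1) {j : I} (hj : j ≠ i) :
    (M.replaceSink hi X φ).space (I := Reflected i) j ≅ M.space j :=
  eqToIso (M.replace_of_ne X hj)

lemma arr_replaceSink_keep (hi : IsQuiverSink i) (M : QuiverRep k I) (X : FGModuleCat.{u} k)
    (φ : ∀ a : Σ j : I, (j ⟶ i), X ⟶ M.space a.1) {j l : I} (hj : j ≠ i) (hl : l ≠ i)
    (a : j ⟶ l) :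
    Paths.arr (I := Reflected i) (j := j) (l := l) (M.replaceSink hi X φ)
        (ReflectedHom.keep hj hl a) =
      (replaceSinkIso hi M X φ hj).hom ≫ Paths.arr M a ≫ (replaceSinkIso hi M X φ hl).inv :=
  Paths.arr_lift _ _

lemma arr_replaceSink_revIn (hi : IsQuiverSink i) (M : QuiverRep k I) (X : FGModuleCat.{u} k)
    (φ : ∀ a : Σ j : I, (j ⟶ i), X ⟶ M.space a.1) {j : I} (a : j ⟶ i) :
    Paths.arr (I := Reflected i) (j := i) (l := j) (M.replaceSink hi X φ)
        (ReflectedHom.revIn a) =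
      (replaceSinkIsoSelf hi M X φ).hom ≫ φ ⟨j, a⟩ ≫
        (replaceSinkIso hi M X φ (hi.ne a)).inv :=
  Paths.arr_lift _ _

variable [Fintype I] [∀ j l : I, Fintype (j ⟶ l)]

/-- The canonical map `⨁ M_l → Coker(M_i → ⨁ M_l) ⊕ V`, with zero second component. -/
abbrev sourcePi (M : QuiverRep k I) (i : I) (V : FGModuleCat.{u} k) :
    ((a : Σ j : I, (i ⟶ j)) → M.space a.1) →ₗ[k]
      (((a : Σ j : I, (i ⟶ j)) → M.space a.1) ⧸ LinearMap.range (M.outMap i)) × V :=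
  LinearMap.inl k _ V ∘ₗ (LinearMap.range (M.outMap i)).mkQ

/-- The canonical map `Ker(⨁ M_j → M_i) ⊕ V → ⨁ M_j`, which is zero on `V`. -/
abbrev sinkIota (M : QuiverRep k I) (i : I) (V : FGModuleCat.{u} k) :
    (LinearMap.ker (M.inMap i) × V) →ₗ[k] ((a : Σ j : I, (j ⟶ i)) → M.space a.1) :=
  (LinearMap.ker (M.inMap i)).subtype ∘ₗ LinearMap.fst k (LinearMap.ker (M.inMap i)) V

/-- An identification of a representation `R` of the reflection at a source `i` with the one obtained
from `M` by replacing `M_i` by `X`, on which the reversed arrows act by the components of a map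
`π : ⨁ M_l → X`. It hides the casts in the construction of `R`. -/
structure SourceReflection (M : QuiverRep k I) (i : I) (X : FGModuleCat.{u} k)
    (π : ((a : Σ j : I, (i ⟶ j)) → M.space a.1) →ₗ[k] X) (R : QuiverRep k (Reflected i)) where
  /-- The identification at `i`. -/
  isoSelf : R.space (I := Reflected i) i ≅ X
  /-- The identifications at the other vertices. -/
  iso (j : {j : I // j ≠ i}) : R.space (I := Reflected i) j.1 ≅ M.space j
  keep (j l : {j : I // j ≠ i}) (a : j.1 ⟶ l.1) :
    Paths.arr (I := Reflected i) (j := j.1) (l := l.1) R (ReflectedHom.keep j.2 l.2 a) =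
      (iso j).hom ≫ Paths.arr M a ≫ (iso l).inv
  revOut [DecidableEq (Σ j : I, (i ⟶ j))] {l : I} (hl : l ≠ i) (a : i ⟶ l) :
    Paths.arr (I := Reflected i) (j := l) (l := i) R (ReflectedHom.revOut a) =
      (iso ⟨l, hl⟩).hom ≫ (FGModuleCat.ofHom
        (π ∘ₗ LinearMap.single k (fun a : Σ j : I, (i ⟶ j) => M.space a.1) ⟨l, a⟩) :
          M.space l ⟶ X) ≫ isoSelf.inv

lemma SourceReflection.finrank_hom (hi : IsQuiverSource i) {M N : QuiverRep k I}
    {X Y : FGModuleCat.{u} k} {π : ((a : Σ j : I, (i ⟶ j)) → M.space a.1) →ₗ[k] X}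
    {ρ : ((a : Σ j : I, (i ⟶ j)) → N.space a.1) →ₗ[k] Y}
    {R S : QuiverRep k (Reflected i)} (r : SourceReflection M i X π R)
    (s : SourceReflection N i Y ρ S) :
    finrank k (R ⟶ S) =
      finrank k (keptSubmodule M N i ⊓ (LinearMap.range (LinearMap.lcomp k Y π)).comap
          (LinearMap.compRight k ρ ∘ₗ diagHom M N i hi.outVertex) :
            Submodule k (AwayHom M N i)) +
      finrank k (LinearMap.ker (LinearMap.lcomp k Y π)) := by
  classical
  let Ψ := splitHom
    (fun j : I => R.space (I := Reflected i) j) (fun j : I => S.space (I := Reflected i) j) i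
    r.isoSelf s.isoSelf r.iso s.iso
  refine finrank_hom_eq_of_split R S Ψ _ _ _ fun f => ?_
  have hd (a : Σ j : I, (i ⟶ j)) := congr_arg (fun g => ρ ∘ₗ g)
    (diagHom_comp_single M N i hi.outVertex (Ψ f).2 a)
  constructor
  · intro h
    refine ⟨fun j l a => ?_, ?_⟩
    · have := h j.1 l.1 (ReflectedHom.keep j.2 l.2 a)
      rw [r.keep, s.keep] at this
      exact (iso_conj_naturality_iff _ _ _ _ _ _ _ _).1 this
    · refine LinearMap.pi_ext' fun a => ?_
      have := h a.1 i (ReflectedHom.revOut a.2)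
      rw [r.revOut (hi.ne a.2), s.revOut (hi.ne a.2)] at this
      refine ((iso_conj_naturality_iff _ _ _ _ _ _ _ _).1 this).trans ?_
      exact (hd a).symm
  · rintro ⟨h1, h2⟩ j l (⟨hj, hl, a⟩ | ⟨a⟩ | ⟨a⟩)
    · rw [r.keep ⟨j, hj⟩ ⟨l, hl⟩, s.keep ⟨j, hj⟩ ⟨l, hl⟩]
      exact (iso_conj_naturality_iff _ _ _ _ _ _ _ _).2 (h1 ⟨j, hj⟩ ⟨l, hl⟩ a)
    · rw [r.revOut (hi.ne a), s.revOut (hi.ne a)]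
      refine (iso_conj_naturality_iff _ _ _ _ _ _ _ _).2 ?_
      have := congr_arg (fun g => g ∘ₗ LinearMap.single k
        (fun a : Σ j : I, (i ⟶ j) => M.space a.1) ⟨j, a⟩) h2
      refine Eq.trans this ?_
      exact hd ⟨j, a⟩
    · exact ((hi _).false a).elim

/-- The tautological identification for `replaceSource`. -/
def SourceReflection.ofReplaceSource (hi : IsQuiverSource i) (M : QuiverRep k I)
    (X : FGModuleCat.{u} k) (π : ((a : Σ j : I, (i ⟶ j)) → M.space a.1) →ₗ[k] X)
    (φ : ∀ a : Σ l : I, (i ⟶ l), M.space a.1 ⟶ X) [inst0 : DecidableEq (Σ j : I, (i ⟶ j))]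
    (hφ : ∀ a, φ a = FGModuleCat.ofHom
        (π ∘ₗ LinearMap.single k (fun a : Σ j : I, (i ⟶ j) => M.space a.1) a)) :
    SourceReflection M i X π (M.replaceSource hi X φ) where
  isoSelf := replaceSourceIsoSelf hi M X _
  iso j := replaceSourceIso hi M X _ j.2
  keep j l a := arr_replaceSource_keep hi M X _ j.2 l.2 a
  revOut {inst} l hl a := by
    rw [Subsingleton.elim inst inst0, ← hφ]
    exact arr_replaceSource_revOut hi M X _ a

open Classical in
lemma DecoratedRep.nonempty_sourceReflection (hi : IsQuiverSource i) (M : DecoratedRep k I) :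
    Nonempty (SourceReflection M.pos i (FGModuleCat.of k
      ((((a : Σ j : I, (i ⟶ j)) → M.pos.space a.1) ⧸ LinearMap.range (M.pos.outMap i)) × M.dec i))
      (sourcePi M.pos i (M.dec i)) (M.sigmaSource hi).pos) := by
  unfold DecoratedRep.sigmaSource
  dsimp only
  exact ⟨SourceReflection.ofReplaceSource hi M.pos _ _ _ fun _ => rfl⟩

/-- An identification of a representation `R` of the reflection at a sink `i` with the one obtained
from `M` by replacing `M_i` by `X`, on which the reversed arrows act by the components of a map
`p : X → ⨁ M_j`. It hides the casts in the construction of `R`. -/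
structure SinkReflection (M : QuiverRep k I) (i : I) (X : FGModuleCat.{u} k)
    (p : X →ₗ[k] ((a : Σ j : I, (j ⟶ i)) → M.space a.1)) (R : QuiverRep k (Reflected i)) where
  /-- The identification at `i`. -/
  isoSelf : R.space (I := Reflected i) i ≅ X
  /-- The identifications at the other vertices. -/
  iso (j : {j : I // j ≠ i}) : R.space (I := Reflected i) j.1 ≅ M.space j
  keep (j l : {j : I // j ≠ i}) (a : j.1 ⟶ l.1) :
    Paths.arr (I := Reflected i) (j := j.1) (l := l.1) R (ReflectedHom.keep j.2 l.2 a) =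
      (iso j).hom ≫ Paths.arr M a ≫ (iso l).inv
  revIn {j : I} (hj : j ≠ i) (a : j ⟶ i) :
    Paths.arr (I := Reflected i) (j := i) (l := j) R (ReflectedHom.revIn a) =
      isoSelf.hom ≫ (FGModuleCat.ofHom (LinearMap.proj (⟨j, a⟩ : Σ j : I, (j ⟶ i)) ∘ₗ p) :
          X ⟶ M.space j) ≫ (iso ⟨j, hj⟩).inv

/-- The tautological identification for `replaceSink`. -/
def SinkReflection.ofReplaceSink (hi : IsQuiverSink i) (M : QuiverRep k I)
    (X : FGModuleCat.{u} k) (p : X →ₗ[k] ((a : Σ j : I, (j ⟶ i)) → M.space a.1))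
    (φ : ∀ a : Σ j : I, (j ⟶ i), X ⟶ M.space a.1)
    (hφ : ∀ a, φ a = FGModuleCat.ofHom (LinearMap.proj a ∘ₗ p)) :
    SinkReflection M i X p (M.replaceSink hi X φ) where
  isoSelf := replaceSinkIsoSelf hi M X _
  iso j := replaceSinkIso hi M X _ j.2
  keep j l a := arr_replaceSink_keep hi M X _ j.2 l.2 a
  revIn {j} hj a := by
    rw [← hφ]
    exact arr_replaceSink_revIn hi M X _ a

lemma DecoratedRep.nonempty_sinkReflection (hi : IsQuiverSink i) (M : DecoratedRep k I) :
    Nonempty (SinkReflection M.pos i (FGModuleCat.of k (LinearMap.ker (M.pos.inMap i) × M.dec i))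
      (sinkIota M.pos i (M.dec i)) (M.sigmaSink hi).pos) := by
  unfold DecoratedRep.sigmaSink
  dsimp only
  exact ⟨SinkReflection.ofReplaceSink hi M.pos _ _ _ fun _ => rfl⟩

lemma SinkReflection.finrank_hom (hi : IsQuiverSink i) {M N : QuiverRep k I}
    {X Y : FGModuleCat.{u} k} {p : X →ₗ[k] ((a : Σ j : I, (j ⟶ i)) → M.space a.1)}
    {q : Y →ₗ[k] ((a : Σ j : I, (j ⟶ i)) → N.space a.1)}
    {R S : QuiverRep k (Reflected i)} (r : SinkReflection M i X p R)
    (s : SinkReflection N i Y q S) :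
    finrank k (R ⟶ S) =
      finrank k (keptSubmodule M N i ⊓ (LinearMap.range (LinearMap.compRight k q :
        (X →ₗ[k] Y) →ₗ[k] _)).comap (LinearMap.lcomp k _ p ∘ₗ diagHom M N i hi.inVertex) :
            Submodule k (AwayHom M N i)) +
      finrank k (LinearMap.ker (LinearMap.compRight k q : (X →ₗ[k] Y) →ₗ[k] _)) := by
  let Ψ := splitHom
    (fun j : I => R.space (I := Reflected i) j) (fun j : I => S.space (I := Reflected i) j) i
    r.isoSelf s.isoSelf r.iso s.iso
  refine finrank_hom_eq_of_split R S Ψ _ _ _ fun f => ?_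
  constructor
  · intro h
    refine ⟨fun j l a => ?_, ?_⟩
    · have := h j.1 l.1 (ReflectedHom.keep j.2 l.2 a)
      rw [r.keep, s.keep] at this
      exact (iso_conj_naturality_iff _ _ _ _ _ _ _ _).1 this
    · refine LinearMap.ext fun x => funext fun a => ?_
      have := h i a.1 (ReflectedHom.revIn a.2)
      rw [r.revIn (hi.ne a.2), s.revIn (hi.ne a.2)] at this
      exact (LinearMap.congr_fun ((iso_conj_naturality_iff _ _ _ _ _ _ _ _).1 this) x).symm
  · rintro ⟨h1, h2⟩ j l (⟨hj, hl, a⟩ | ⟨a⟩ | ⟨a⟩)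
    · rw [r.keep ⟨j, hj⟩ ⟨l, hl⟩, s.keep ⟨j, hj⟩ ⟨l, hl⟩]
      exact (iso_conj_naturality_iff _ _ _ _ _ _ _ _).2 (h1 ⟨j, hj⟩ ⟨l, hl⟩ a)
    · exact ((hi _).false a).elim
    · rw [r.revIn (hi.ne a), s.revIn (hi.ne a)]
      refine (iso_conj_naturality_iff _ _ _ _ _ _ _ _).2 (LinearMap.ext fun x => ?_)
      exact (congr_fun (LinearMap.congr_fun h2 x) ⟨l, a⟩).symm

lemma QuiverRep.inMap_comp_single [DecidableEq (Σ j : I, (j ⟶ i))] (M : QuiverRep k I)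
    (a : Σ j : I, (j ⟶ i)) :
    M.inMap i ∘ₗ LinearMap.single k (fun a : Σ j : I, (j ⟶ i) => M.space a.1) a =
      M.arrowMap a.2 := by
  ext x
  simp only [QuiverRep.inMap, LinearMap.comp_apply, LinearMap.sum_apply]
  refine (Finset.sum_eq_single a (fun b _ hb => ?_) (by simp)).trans ?_
  · simp [hb]
  · simp

lemma IsQuiverSink.finrank_hom (hi : IsQuiverSink i) (M N : QuiverRep k I) :
    finrank k (M ⟶ N) =
      finrank k (keptSubmodule M N i ⊓ (LinearMap.range
        (LinearMap.lcomp k (N.space i) (M.inMap i))).comap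
          (LinearMap.compRight k (N.inMap i) ∘ₗ diagHom M N i hi.inVertex) :
            Submodule k (AwayHom M N i)) +
      finrank k (LinearMap.ker (LinearMap.lcomp k (N.space i) (M.inMap i))) := by
  classical
  let Ψ := splitHom (fun j => M.space j) (fun j => N.space j) i
    (Iso.refl _) (Iso.refl _) (fun j => Iso.refl _) (fun j => Iso.refl _)
  refine finrank_hom_eq_of_split M N Ψ _ _ _ fun f => ?_
  have hd (a : Σ j : I, (j ⟶ i)) : (N.inMap i ∘ₗ diagHom M N i hi.inVertex (Ψ f).2) ∘ₗ
      LinearMap.single k (fun a : Σ j : I, (j ⟶ i) => M.space a.1) a =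
        N.arrowMap a.2 ∘ₗ (Ψ f).2 (hi.inVertex a) :=
    (congr_arg (fun g => N.inMap i ∘ₗ g)
      (diagHom_comp_single M N i hi.inVertex (Ψ f).2 a)).trans
      (congr_arg (fun g => g ∘ₗ (Ψ f).2 (hi.inVertex a)) (N.inMap_comp_single a))
  have hd' (a : Σ j : I, (j ⟶ i)) : ((Ψ f).1 ∘ₗ M.inMap i) ∘ₗ
      LinearMap.single k (fun a : Σ j : I, (j ⟶ i) => M.space a.1) a =
        (Ψ f).1 ∘ₗ M.arrowMap a.2 :=
    congr_arg (fun g => (Ψ f).1 ∘ₗ g) (M.inMap_comp_single a)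
  have key {j l : I} (a : j ⟶ l) := iso_conj_naturality_iff (Iso.refl _) (Iso.refl _)
    (Iso.refl _) (Iso.refl _) (Paths.arr M a) (Paths.arr N a) (f j) (f l)
  simp only [Iso.refl_hom, Iso.refl_inv, Category.id_comp, Category.comp_id] at key
  constructor
  · intro h
    refine ⟨fun j l a => (key a).1 (h _ _ a), LinearMap.pi_ext' fun a => ?_⟩
    exact (hd' a).trans (((key a.2).1 (h _ _ a.2)).trans (hd a).symm)
  · rintro ⟨h1, h2⟩ j l a
    rw [key a]
    rcases eq_or_ne l i with rfl | hl
    · exact (hd' ⟨j, a⟩).symm.trans ((congr_arg (fun g => g ∘ₗ LinearMap.single k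
        (fun a : Σ j : I, (j ⟶ l) => M.space a.1) ⟨j, a⟩) h2).trans (hd ⟨j, a⟩))
    · exact h1 ⟨j, hi.source_ne a⟩ ⟨l, hl⟩ a

/-- The arrows of a quiver with a sink `i`: those not touching `i`, and those ending at `i`. -/
def IsQuiverSink.arrowEquiv (hi : IsQuiverSink i) :
    KeptArrow i ⊕ (Σ l : I, (l ⟶ i)) ≃ Σ j l : I, (j ⟶ l) :=
  Equiv.ofBijective
    (Sum.elim (fun a => ⟨a.1.1, a.2.1.1, a.2.2⟩) (fun a => ⟨a.1, i, a.2⟩)) (by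
    constructor
    · rintro (⟨⟨j, hj⟩, ⟨l, hl⟩, a⟩ | ⟨l, a⟩) (⟨⟨j', hj'⟩, ⟨l', hl'⟩, a'⟩ | ⟨l', a'⟩) h
      · cases h; rfl
      · exact (hl (congr_arg (fun x => x.2.1) h)).elim
      · exact (hl' (congr_arg (fun x => x.2.1) h).symm).elim
      · cases h; rfl
    · rintro ⟨j, l, a⟩
      rcases eq_or_ne l i with rfl | hl
      · exact ⟨Sum.inr ⟨j, a⟩, rfl⟩
      · exact ⟨Sum.inl ⟨⟨j, hi.source_ne a⟩, ⟨l, hl⟩, a⟩, rfl⟩)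

/-- The arrows of the reflection at a sink `i`: the kept ones, and the reversals of the arrows that
end at `i`. -/
def IsQuiverSink.reflectedArrowEquiv (hi : IsQuiverSink i) :
    KeptArrow i ⊕ (Σ l : I, (l ⟶ i)) ≃ Σ j l : Reflected i, (j ⟶ l) :=
  Equiv.ofBijective
    (Sum.elim (fun a => ⟨a.1.1, a.2.1.1, ReflectedHom.keep a.1.2 a.2.1.2 a.2.2⟩)
      (fun a => ⟨i, a.1, ReflectedHom.revIn a.2⟩)) (by
    constructor
    · rintro (⟨⟨j, hj⟩, ⟨l, hl⟩, a⟩ | ⟨l, a⟩) (⟨⟨j', hj'⟩, ⟨l', hl'⟩, a'⟩ | ⟨l', a'⟩) h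
      · cases h; rfl
      · exact (hj (congr_arg (fun x => x.1) h)).elim
      · exact (hj' (congr_arg (fun x => x.1) h).symm).elim
      · cases h; rfl
    · rintro ⟨j, l, ⟨hj, hl, a⟩ | ⟨a⟩ | ⟨a⟩⟩
      · exact ⟨Sum.inl ⟨⟨j, hj⟩, ⟨l, hl⟩, a⟩, rfl⟩
      · exact ((hi _).false a).elim
      · exact ⟨Sum.inr ⟨_, a⟩, rfl⟩)

end Source

/-! ### Extension spaces and reflections -/

section Numerics
open Module
variable {k : Type u} [Field k] {I : Type u} [Quiver.{u} I] [DecidableEq I] {i : I}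
  [Fintype I] [∀ j l : I, Fintype (j ⟶ l)]

lemma IsQuiverSource.finrank_ext1_add (hi : IsQuiverSource i) (M N : QuiverRep k I) :
    finrank k (M.Ext1 N) +
        (finrank k (M.space i) * finrank k (N.space i) + awaySum M N i) =
      finrank k (M ⟶ N) + (keptSum M N i +
        finrank k (M.space i) * finrank k ((a : Σ j : I, (i ⟶ j)) → N.space a.1)) := by
  have h := M.finrank_ext1_add N
  rw [Fintype.sum_eq_add_sum_subtype_ne _ i, ← hi.arrowEquiv.sum_comp, Fintype.sum_sum_type] at h
  rw [finrank_pi_fintype, Finset.mul_sum]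
  exact h

lemma IsQuiverSink.finrank_ext1_add (hi : IsQuiverSink i) (M N : QuiverRep k I) :
    finrank k (M.Ext1 N) +
        (finrank k (M.space i) * finrank k (N.space i) + awaySum M N i) =
      finrank k (M ⟶ N) + (keptSum M N i +
        finrank k ((a : Σ j : I, (j ⟶ i)) → M.space a.1) * finrank k (N.space i)) := by
  have h := M.finrank_ext1_add N
  rw [Fintype.sum_eq_add_sum_subtype_ne _ i, ← hi.arrowEquiv.sum_comp, Fintype.sum_sum_type] at h
  rw [finrank_pi_fintype, Finset.sum_mul]
  exact h

lemma IsQuiverSource.finite_ext1_reflected (hi : IsQuiverSource i)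
    (R S : QuiverRep k (Reflected i)) : Module.Finite k (R.Ext1 S) :=
  let := Fintype.ofEquiv _ hi.reflectedArrowEquiv
  R.finite_ext1 S

lemma IsQuiverSink.finite_ext1_reflected (hi : IsQuiverSink i)
    (R S : QuiverRep k (Reflected i)) : Module.Finite k (R.Ext1 S) :=
  let := Fintype.ofEquiv _ hi.reflectedArrowEquiv
  R.finite_ext1 S

lemma SourceReflection.finrank_ext1_add (hi : IsQuiverSource i) {M N : QuiverRep k I}
    {X Y : FGModuleCat.{u} k} {π : ((a : Σ j : I, (i ⟶ j)) → M.space a.1) →ₗ[k] X}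
    {ρ : ((a : Σ j : I, (i ⟶ j)) → N.space a.1) →ₗ[k] Y}
    {R S : QuiverRep k (Reflected i)} (r : SourceReflection M i X π R)
    (s : SourceReflection N i Y ρ S) :
    finrank k (R.Ext1 S) + (finrank k X * finrank k Y + awaySum M N i) =
      finrank k (R ⟶ S) + (keptSum M N i +
        finrank k ((a : Σ j : I, (i ⟶ j)) → M.space a.1) * finrank k Y) := by
  let := Fintype.ofEquiv _ hi.reflectedArrowEquiv
  have h := R.finrank_ext1_add S
  have hr (j : {j : I // j ≠ i}) := (FGModuleCat.isoToLinearEquiv (r.iso j)).finrank_eq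
  have hs (j : {j : I // j ≠ i}) := (FGModuleCat.isoToLinearEquiv (s.iso j)).finrank_eq
  have h1 : ∑ j : Reflected i, finrank k (R.space j) * finrank k (S.space j) =
      finrank k X * finrank k Y + awaySum M N i := by
    refine (Fintype.sum_eq_add_sum_subtype_ne (α := I) _ i).trans ?_
    rw [(FGModuleCat.isoToLinearEquiv r.isoSelf).finrank_eq,
      (FGModuleCat.isoToLinearEquiv s.isoSelf).finrank_eq]
    exact congr_arg _ (Finset.sum_congr rfl fun j _ => by rw [← hr j, ← hs j])
  have h2 : ∑ a : Σ j l : Reflected i, (j ⟶ l),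
      finrank k (R.space a.1) * finrank k (S.space a.2.1) =
      keptSum M N i + finrank k ((a : Σ j : I, (i ⟶ j)) → M.space a.1) * finrank k Y := by
    rw [← hi.reflectedArrowEquiv.sum_comp, Fintype.sum_sum_type, finrank_pi_fintype,
      Finset.sum_mul]
    refine congr_arg₂ _ (Finset.sum_congr rfl fun a _ => ?_) (Finset.sum_congr rfl fun a _ => ?_)
    · rw [← hr, ← hs]; rfl
    · exact congr_arg₂ _ (hr (hi.outVertex a)) (FGModuleCat.isoToLinearEquiv s.isoSelf).finrank_eq
  rw [← h1, ← h2]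
  exact h

lemma SinkReflection.finrank_ext1_add (hi : IsQuiverSink i) {M N : QuiverRep k I}
    {X Y : FGModuleCat.{u} k} {p : X →ₗ[k] ((a : Σ j : I, (j ⟶ i)) → M.space a.1)}
    {q : Y →ₗ[k] ((a : Σ j : I, (j ⟶ i)) → N.space a.1)}
    {R S : QuiverRep k (Reflected i)} (r : SinkReflection M i X p R)
    (s : SinkReflection N i Y q S) :
    finrank k (R.Ext1 S) + (finrank k X * finrank k Y + awaySum M N i) =
      finrank k (R ⟶ S) + (keptSum M N i +
        finrank k X * finrank k ((a : Σ j : I, (j ⟶ i)) → N.space a.1)) := by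
  let := Fintype.ofEquiv _ hi.reflectedArrowEquiv
  have h := R.finrank_ext1_add S
  have hr (j : {j : I // j ≠ i}) := (FGModuleCat.isoToLinearEquiv (r.iso j)).finrank_eq
  have hs (j : {j : I // j ≠ i}) := (FGModuleCat.isoToLinearEquiv (s.iso j)).finrank_eq
  have h1 : ∑ j : Reflected i, finrank k (R.space j) * finrank k (S.space j) =
      finrank k X * finrank k Y + awaySum M N i := by
    refine (Fintype.sum_eq_add_sum_subtype_ne (α := I) _ i).trans ?_
    rw [(FGModuleCat.isoToLinearEquiv r.isoSelf).finrank_eq,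
      (FGModuleCat.isoToLinearEquiv s.isoSelf).finrank_eq]
    exact congr_arg _ (Finset.sum_congr rfl fun j _ => by rw [← hr j, ← hs j])
  have h2 : ∑ a : Σ j l : Reflected i, (j ⟶ l),
      finrank k (R.space a.1) * finrank k (S.space a.2.1) =
      keptSum M N i + finrank k X * finrank k ((a : Σ j : I, (j ⟶ i)) → N.space a.1) := by
    rw [← hi.reflectedArrowEquiv.sum_comp, Fintype.sum_sum_type, finrank_pi_fintype,
      Finset.mul_sum]
    refine congr_arg₂ _ (Finset.sum_congr rfl fun a _ => ?_) (Finset.sum_congr rfl fun a _ => ?_)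
    · rw [← hr, ← hs]; rfl
    · exact congr_arg₂ _ (FGModuleCat.isoToLinearEquiv r.isoSelf).finrank_eq (hs (hi.inVertex a))
  rw [← h1, ← h2]
  exact h

/-- `dim Ext¹(ΣM, ΣN) + m b + m n_out + c y` equals
`dim Ext¹(M, N) + m n + m_out y`, where `m`, `n` are the dimensions of `M_i`, `N_i`, those of the sums
over the arrows at `i` are `m_out`, `n_out`, those of the cokernel of `M_i → ⨁ M_l` and the kernel of
`N_i → ⨁ N_l` are `c` and `b`, and that of the new space of `N` at `i` is `y`. -/
lemma IsQuiverSource.finrank_ext1_sigmaSource (hi : IsQuiverSource i) (M N : DecoratedRep k I) :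
    finrank k ((M.sigmaSource hi).pos.Ext1 (N.sigmaSource hi).pos) +
        finrank k (M.pos.space i) * finrank k (LinearMap.ker (N.pos.outMap i)) +
        finrank k (M.pos.space i) * finrank k ((a : Σ j : I, (i ⟶ j)) → N.pos.space a.1) +
        finrank k (((a : Σ j : I, (i ⟶ j)) → M.pos.space a.1) ⧸ LinearMap.range (M.pos.outMap i)) *
          finrank k ((((a : Σ j : I, (i ⟶ j)) → N.pos.space a.1) ⧸
            LinearMap.range (N.pos.outMap i)) × N.dec i) =
      finrank k (M.pos.Ext1 N.pos) +
        finrank k (M.pos.space i) * finrank k (N.pos.space i) +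
        finrank k ((a : Σ j : I, (i ⟶ j)) → M.pos.space a.1) *
          finrank k ((((a : Σ j : I, (i ⟶ j)) → N.pos.space a.1) ⧸
            LinearMap.range (N.pos.outMap i)) × N.dec i) := by
  obtain ⟨r⟩ := M.nonempty_sourceReflection hi
  obtain ⟨s⟩ := N.nonempty_sourceReflection hi
  have h1 := hi.finrank_ext1_add M.pos N.pos
  have h2 := hi.finrank_hom M.pos N.pos
  have h3 := SourceReflection.finrank_ext1_add hi r s
  have h4 := SourceReflection.finrank_hom hi r s
  have h5 := finrank_ker_precomp_add (X' := ((((a : Σ j : I, (i ⟶ j)) → N.pos.space a.1) ⧸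
          LinearMap.range (N.pos.outMap i)) × N.dec i)) (sourcePi M.pos i (M.dec i))
  have h6 : finrank k (LinearMap.range (sourcePi M.pos i (M.dec i))) =
      finrank k (((a : Σ j : I, (i ⟶ j)) → M.pos.space a.1) ⧸
        LinearMap.range (M.pos.outMap i)) := by
    rw [LinearMap.range_comp_of_range_eq_top _ (Submodule.range_mkQ _)]
    exact LinearMap.finrank_range_of_inj LinearMap.inl_injective
  -- A family away from `i` extends to a morphism `M ⟶ N` if and only if it extends to a morphism
  -- of the reflected representations.
  have h7 : (LinearMap.range (LinearMap.compRight k (N.pos.outMap i) :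
        (M.pos.space i →ₗ[k] N.pos.space i) →ₗ[k] _)).comap
          (LinearMap.lcomp k _ (M.pos.outMap i) ∘ₗ diagHom M.pos N.pos i hi.outVertex) =
      (LinearMap.range (LinearMap.lcomp k ((((a : Σ j : I, (i ⟶ j)) → N.pos.space a.1) ⧸
          LinearMap.range (N.pos.outMap i)) × N.dec i) (sourcePi M.pos i (M.dec i)))).comap
        (LinearMap.compRight k (sourcePi N.pos i (N.dec i)) ∘ₗ
          diagHom M.pos N.pos i hi.outVertex) := by
    ext f
    exact exists_comp_eq_comp_iff_coker (M.pos.outMap i) (N.pos.outMap i)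
      (diagHom M.pos N.pos i hi.outVertex f)
  rw [h7] at h2
  rw [h6] at h5
  dsimp only [FGModuleCat.of_carrier] at h3 h4
  linarith

/-- The analogue of `IsQuiverSource.finrank_ext1_sigmaSource` for a sink. -/
lemma IsQuiverSink.finrank_ext1_sigmaSink (hi : IsQuiverSink i) (M N : DecoratedRep k I) :
    finrank k ((M.sigmaSink hi).pos.Ext1 (N.sigmaSink hi).pos) +
        finrank k (LinearMap.ker (M.pos.inMap i) × M.dec i) *
          finrank k (LinearMap.ker (N.pos.inMap i) × N.dec i) +
        finrank k ((a : Σ j : I, (j ⟶ i)) → M.pos.space a.1) * finrank k (N.pos.space i) =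
      finrank k (M.pos.Ext1 N.pos) +
        finrank k (LinearMap.range (M.pos.inMap i)) * finrank k (N.pos.space i) +
        finrank k (LinearMap.ker (M.pos.inMap i) × M.dec i) * finrank k (N.dec i) +
        finrank k (LinearMap.ker (M.pos.inMap i) × M.dec i) *
          finrank k ((a : Σ j : I, (j ⟶ i)) → N.pos.space a.1) := by
  obtain ⟨r⟩ := M.nonempty_sinkReflection hi
  obtain ⟨s⟩ := N.nonempty_sinkReflection hi
  have h1 := hi.finrank_ext1_add M.pos N.pos
  have h2 := hi.finrank_hom M.pos N.pos
  have h3 := SinkReflection.finrank_ext1_add hi r s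
  have h4 := SinkReflection.finrank_hom hi r s
  have h5 := finrank_ker_precomp_add (X' := N.pos.space i) (M.pos.inMap i)
  have h6 : finrank k (LinearMap.ker (sinkIota N.pos i (N.dec i))) = finrank k (N.dec i) := by
    rw [LinearMap.ker_comp_of_ker_eq_bot _ (Submodule.ker_subtype _), LinearMap.ker_fst]
    exact LinearMap.finrank_range_of_inj LinearMap.inr_injective
  -- A family away from `i` extends to a morphism `M ⟶ N` if and only if it extends to a morphism
  -- of the reflected representations.
  have h7 : (LinearMap.range (LinearMap.lcomp k (N.pos.space i) (M.pos.inMap i))).comap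
          (LinearMap.compRight k (N.pos.inMap i) ∘ₗ diagHom M.pos N.pos i hi.inVertex) =
      (LinearMap.range (LinearMap.compRight k (sinkIota N.pos i (N.dec i)) :
        ((LinearMap.ker (M.pos.inMap i) × M.dec i) →ₗ[k] _) →ₗ[k] _)).comap
        (LinearMap.lcomp k _ (sinkIota M.pos i (M.dec i)) ∘ₗ
          diagHom M.pos N.pos i hi.inVertex) := by
    ext f
    exact exists_comp_eq_comp_iff_ker (M.pos.inMap i) (N.pos.inMap i)
      (diagHom M.pos N.pos i hi.inVertex f)
  have h8 := finrank_ker_postcomp (X := LinearMap.ker (M.pos.inMap i) × M.dec i)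
    (sinkIota N.pos i (N.dec i))
  rw [h7] at h2
  rw [h6] at h8
  dsimp only [FGModuleCat.of_carrier] at h3 h4
  linarith

end Numerics

/-! ### The dimension of `E(M, N)` under reflection -/

section Final
open Module
variable {k : Type u} [Field k]

lemma DecoratedRep.finrank_E {Q : Type u} [Quiver.{u} Q] [Fintype Q] (M N : DecoratedRep k Q)
    [Module.Finite k (M.pos.Ext1 N.pos)] [Module.Finite k (N.pos.Ext1 M.pos)] :
    finrank k (DecoratedRep.E M N) = finrank k (M.pos.Ext1 N.pos) + (finrank k (N.pos.Ext1 M.pos) +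
      (∑ j : Q, finrank k (M.pos.space j) * finrank k (N.dec j) +
        ∑ j : Q, finrank k (M.dec j) * finrank k (N.pos.space j))) := by
  rw [finrank_prod, finrank_prod, finrank_prod, Subspace.dual_finrank_eq, finrank_pi_fintype,
    finrank_pi_fintype]
  simp only [finrank_linearMap]

variable {I : Type u} [Quiver.{u} I] [DecidableEq I] {i : I} [Fintype I]
  [∀ j l : I, Fintype (j ⟶ l)]

lemma DecoratedRep.sum_sigmaSource (hi : IsQuiverSource i) (M N : DecoratedRep k I) :
    ∑ j : Reflected i, finrank k ((M.sigmaSource hi).pos.space j) *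
        finrank k ((N.sigmaSource hi).dec j) =
      finrank k ((((a : Σ j : I, (i ⟶ j)) → M.pos.space a.1) ⧸
          LinearMap.range (M.pos.outMap i)) × M.dec i) *
        finrank k (LinearMap.ker (N.pos.outMap i)) +
      ∑ j : {j : I // j ≠ i}, finrank k (M.pos.space j) * finrank k (N.dec j) := by
  obtain ⟨r⟩ := M.nonempty_sourceReflection hi
  refine (Fintype.sum_eq_add_sum_subtype_ne (α := I) _ i).trans ?_
  refine congr_arg₂ _ (congr_arg₂ _ ?_ ?_) (Finset.sum_congr rfl fun j _ => congr_arg₂ _ ?_ ?_)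
  · exact (FGModuleCat.isoToLinearEquiv r.isoSelf).finrank_eq
  · exact congr_arg (fun X : FGModuleCat.{u} k => finrank k X)
      (Function.update_self (β := fun _ : I => FGModuleCat.{u} k) i _ N.dec)
  · exact (FGModuleCat.isoToLinearEquiv (r.iso j)).finrank_eq
  · exact congr_arg (fun X : FGModuleCat.{u} k => finrank k X)
      (Function.update_of_ne (β := fun _ : I => FGModuleCat.{u} k) j.2 _ N.dec)

lemma DecoratedRep.sum_sigmaSink (hi : IsQuiverSink i) (M N : DecoratedRep k I) :
    ∑ j : Reflected i, finrank k ((M.sigmaSink hi).pos.space j) *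
        finrank k ((N.sigmaSink hi).dec j) =
      finrank k (LinearMap.ker (M.pos.inMap i) × M.dec i) *
        finrank k (N.pos.space i ⧸ LinearMap.range (N.pos.inMap i)) +
      ∑ j : {j : I // j ≠ i}, finrank k (M.pos.space j) * finrank k (N.dec j) := by
  obtain ⟨r⟩ := M.nonempty_sinkReflection hi
  refine (Fintype.sum_eq_add_sum_subtype_ne (α := I) _ i).trans ?_
  refine congr_arg₂ _ (congr_arg₂ _ ?_ ?_) (Finset.sum_congr rfl fun j _ => congr_arg₂ _ ?_ ?_)
  · exact (FGModuleCat.isoToLinearEquiv r.isoSelf).finrank_eq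
  · exact congr_arg (fun X : FGModuleCat.{u} k => finrank k X)
      (Function.update_self (β := fun _ : I => FGModuleCat.{u} k) i _ N.dec)
  · exact (FGModuleCat.isoToLinearEquiv (r.iso j)).finrank_eq
  · exact congr_arg (fun X : FGModuleCat.{u} k => finrank k X)
      (Function.update_of_ne (β := fun _ : I => FGModuleCat.{u} k) j.2 _ N.dec)

lemma DecoratedRep.finrank_E_sigmaSource (hi : IsQuiverSource i) (M N : DecoratedRep k I) :
    finrank k (DecoratedRep.E (M.sigmaSource hi) (N.sigmaSource hi)) =
      finrank k (DecoratedRep.E M N) := by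
  have := hi.finite_ext1_reflected (M.sigmaSource hi).pos (N.sigmaSource hi).pos
  have := hi.finite_ext1_reflected (N.sigmaSource hi).pos (M.sigmaSource hi).pos
  have h1 := hi.finrank_ext1_sigmaSource M N
  have h2 := hi.finrank_ext1_sigmaSource N M
  have hM := (M.pos.outMap i).finrank_range_add_finrank_ker
  have hN := (N.pos.outMap i).finrank_range_add_finrank_ker
  have hM' := (LinearMap.range (M.pos.outMap i)).finrank_quotient_add_finrank
  have hN' := (LinearMap.range (N.pos.outMap i)).finrank_quotient_add_finrank
  rw [DecoratedRep.finrank_E, DecoratedRep.finrank_E]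
  have e (A B : DecoratedRep k (Reflected i)) :
      ∑ j : Reflected i, finrank k (A.dec j) * finrank k (B.pos.space j) =
        ∑ j : Reflected i, finrank k (B.pos.space j) * finrank k (A.dec j) :=
    Finset.sum_congr rfl fun _ _ => mul_comm _ _
  rw [e, DecoratedRep.sum_sigmaSource, DecoratedRep.sum_sigmaSource,
    Fintype.sum_eq_add_sum_subtype_ne (fun j => finrank k (M.pos.space j) * _) i,
    Fintype.sum_eq_add_sum_subtype_ne (fun j => finrank k (M.dec j) * _) i]
  simp only [mul_comm (finrank k (M.dec _))]
  simp only [finrank_prod] at *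
  rw [← hM, ← hN, ← hM', ← hN'] at h1 h2
  rw [← hM, ← hN]
  linarith

lemma DecoratedRep.finrank_E_sigmaSink (hi : IsQuiverSink i) (M N : DecoratedRep k I) :
    finrank k (DecoratedRep.E (M.sigmaSink hi) (N.sigmaSink hi)) =
      finrank k (DecoratedRep.E M N) := by
  have := hi.finite_ext1_reflected (M.sigmaSink hi).pos (N.sigmaSink hi).pos
  have := hi.finite_ext1_reflected (N.sigmaSink hi).pos (M.sigmaSink hi).pos
  have h1 := hi.finrank_ext1_sigmaSink M N
  have h2 := hi.finrank_ext1_sigmaSink N M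
  have hM := (M.pos.inMap i).finrank_range_add_finrank_ker
  have hN := (N.pos.inMap i).finrank_range_add_finrank_ker
  have hM' := (LinearMap.range (M.pos.inMap i)).finrank_quotient_add_finrank
  have hN' := (LinearMap.range (N.pos.inMap i)).finrank_quotient_add_finrank
  rw [DecoratedRep.finrank_E, DecoratedRep.finrank_E]
  have e (A B : DecoratedRep k (Reflected i)) :
      ∑ j : Reflected i, finrank k (A.dec j) * finrank k (B.pos.space j) =
        ∑ j : Reflected i, finrank k (B.pos.space j) * finrank k (A.dec j) :=
    Finset.sum_congr rfl fun _ _ => mul_comm _ _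
  rw [e, DecoratedRep.sum_sigmaSink, DecoratedRep.sum_sigmaSink,
    Fintype.sum_eq_add_sum_subtype_ne (fun j => finrank k (M.pos.space j) * _) i,
    Fintype.sum_eq_add_sum_subtype_ne (fun j => finrank k (M.dec j) * _) i]
  simp only [mul_comm (finrank k (M.dec _))]
  simp only [finrank_prod] at *
  rw [← hM, ← hN, ← hN'] at h1
  rw [← hM, ← hN, ← hM'] at h2
  rw [← hM', ← hN']
  linarith

end Final

end

theorem theorem4p7 {k : Type u} [Field k] [IsAlgClosed k] {I : Type u} [Fintype I] [DecidableEq I]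
    [Quiver.{u} I] [∀ j l : I, Fintype (j ⟶ l)] (_hΓ : IsDynkinQuiver I) (i : I)
    (M N : DecoratedRep k I) :
    (∀ hi : IsQuiverSource i,
      Nonempty (DecoratedRep.E (M.sigmaSource hi) (N.sigmaSource hi) ≃ₗ[k] DecoratedRep.E M N)) ∧
    (∀ hi : IsQuiverSink i,
      Nonempty (DecoratedRep.E (M.sigmaSink hi) (N.sigmaSink hi) ≃ₗ[k] DecoratedRep.E M N)) := by
  refine ⟨fun hi => ?_, fun hi => ?_⟩
  · have := hi.finite_ext1_reflected (M.sigmaSource hi).pos (N.sigmaSource hi).pos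
    have := hi.finite_ext1_reflected (N.sigmaSource hi).pos (M.sigmaSource hi).pos
    exact FiniteDimensional.nonempty_linearEquiv_of_finrank_eq (DecoratedRep.finrank_E_sigmaSource hi M N)
  · have := hi.finite_ext1_reflected (M.sigmaSink hi).pos (N.sigmaSink hi).pos
    have := hi.finite_ext1_reflected (N.sigmaSink hi).pos (M.sigmaSink hi).pos
    exact FiniteDimensional.nonempty_linearEquiv_of_finrank_eq (DecoratedRep.finrank_E_sigmaSink hi M N)
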